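/- Let $p$ be a prime. For $1\le i\le 3$ let $R_i$ be a complete discrete valuation ring of characteristic $0$ with perfect residue field $k_i$ of characteristic $p$, let $\mathfrak m_i$ be its maximal ideal and $\nu_i$ its valuation, normalized so that uniformizers have value $1$; let $L_i$ be its fraction field and $K_i\subseteq L_i$ the fraction field of the Witt ring $W(k_i)$, canonically embedded in $R_i$. Let $\widetilde{\nu_i}$ be the unique extension of $\nu_i/\nu_i(p)$ to an algebraic closure $L_i^{alg}$, and for $n\ge 1$ put $R_{i,n}=R_i/\mathfrak m_i^n$. All homomorphisms are ring homomorphisms, and the maximum of the empty set is $-\infty$. For a uniformizer $\pi$ of $R_i$ put $M(R_i)=\max\{\widetilde{\nu_i}(\pi-\sigma(\pi)) : \sigma\in\mathrm{Hom}_{K_i}(L_i,L_i^{alg}),\ \sigma(\pi)\ne\pi\}$ (this does not depend on $\pi$). A homomorphism $g:R_i\to R_j$ is called a *lifting* of a homomorphism $\phi:R_{i,n}\to R_{j,m}$ ($n,m\ge1$) at a uniformizer $\pi$ of $R_i$ if * there is a representative $\beta\in R_j$ of $\phi(\pi+\mathfrak m_i^{n})$ with $$\widetilde{\nu_j}\big(g(\pi)-\beta\big)>\max\big\{\widetilde{\nu_j}\big(\sigma(g(\pi))-\beta\big)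 : \sigma\in \mathrm{Hom}_{K_j}(L_j,L_j^{alg}),\ \sigma(g(\pi))\neq g(\pi)\big\},\ \text{and}$$ * $g$ and $\phi$ induce the same map on residue fields: $\phi_{red}\circ \mathrm{pr}_i=\mathrm{pr}_j\circ g$, where $\mathrm{pr}_i:R_i\to k_i$ and $\mathrm{pr}_j:R_j\to k_j$ are the projections and $\phi_{red}:k_i\to k_j$ is the reduction of $\phi$. **Proposition.** Let $n_1,n_2,n_3\ge 1$, let $\phi^{1,2}:R_{1,n_1}\to R_{2,n_2}$ and $\phi^{2,3}:R_{2,n_2}\to R_{3,n_3}$ be homomorphisms, let $g^{1,2}:R_1\to R_2$ be a lifting of $\phi^{1,2}$ at some uniformizer of $R_1$ and $g^{2,3}:R_2\to R_3$ a lifting of $\phi^{2,3}$ at some uniformizer of $R_2$. Suppose $\nu_1(p)=\nu_2(p)$. Then $g=g^{2,3}\circ g^{1,2}$ is a lifting of $\phi^{2,3}\circ\phi^{1,2}$ at every uniformizer of $R_1$. If moreover $n_3>M(R_2)\,\nu_2(p)\,\nu_3(p)$ and $n_2>M(R_1)\,\nu_1(p)\,\nu_2(p)$, then $g$ is the unique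 lifting of $\phi^{2,3}\circ\phi^{1,2}$: every homomorphism $R_1\to R_3$ that is a lifting of $\phi^{2,3}\circ\phi^{1,2}$ at some uniformizer of $R_1$ equals $g$. -/

import Mathlib

open IsLocalRing

noncomputable section

namespace ResidueLifting

/-- A complete discrete valuation ring of mixed characteristic `(0, p)` is `p`-adically complete. -/
theorem isAdicComplete_span_p (p : ℕ) [Fact p.Prime] (R : Type*) [CommRing R]
    [IsDomain R] [IsDiscreteValuationRing R] [CharZero R]
    [IsAdicComplete (maximalIdeal R) R] [CharP (ResidueField R) p] :
    IsAdicComplete (Ideal.span {(p : R)}) R := by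
  have hp0 : (p : R) ≠ 0 := by exact_mod_cast (Fact.out : p.Prime).ne_zero
  have hpm : (p : R) ∈ maximalIdeal R := by
    rw [← residue_eq_zero_iff, map_natCast, CharP.cast_eq_zero]
  obtain ⟨ϖ, hϖ⟩ := IsDiscreteValuationRing.exists_irreducible R
  have hle : Ideal.span {(p : R)} ≤ maximalIdeal R := by
    rw [Ideal.span_le]; simpa using hpm
  obtain ⟨e, he⟩ := (IsDiscreteValuationRing.ideal_eq_span_pow_irreducible
    (s := Ideal.span {(p : R)}) (by simpa using hp0) hϖ)
  rw [← Ideal.span_singleton_pow, ← hϖ.maximalIdeal_eq] at he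
  have he0 : e ≠ 0 := by
    rintro rfl
    rw [pow_zero] at he
    rw [he, Ideal.one_eq_top] at hle
    exact Ideal.IsPrime.ne_top' (top_le_iff.mp hle)
  have h1 : IsHausdorff (Ideal.span {(p : R)}) R := ⟨fun x hx => by
    refine IsHausdorff.haus (I := maximalIdeal R) inferInstance x fun n => ?_
    have := hx n
    simp only [smul_eq_mul, Ideal.mul_top] at this ⊢
    exact this.mono (Ideal.pow_right_mono hle n)⟩
  have h2 : IsPrecomplete (Ideal.span {(p : R)}) R := ⟨fun f hf => by
    simp only [smul_eq_mul, Ideal.mul_top] at hf ⊢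
    obtain ⟨L, hL⟩ := IsPrecomplete.prec (I := maximalIdeal R) (M := R) inferInstance (f := f)
      (fun {m n} hmn => by
        simp only [smul_eq_mul, Ideal.mul_top]
        exact (hf hmn).mono (Ideal.pow_right_mono hle m))
    simp only [smul_eq_mul, Ideal.mul_top] at hL
    refine ⟨L, fun n => (hf (n := e * n) (Nat.le_mul_of_pos_left n (Nat.pos_of_ne_zero he0))).trans ?_⟩
    rw [he, ← pow_mul]
    exact hL _⟩
  exact ⟨⟩

/-- There is exactly one ring homomorphism `W(k) → R` inducing the identity on the residue
field `k` (the residue of a Witt vector being its zeroth component). -/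
theorem existsUnique_wittHom (p : ℕ) [Fact p.Prime] (R : Type*) [CommRing R]
    [IsDomain R] [IsDiscreteValuationRing R] [CharZero R]
    [IsAdicComplete (maximalIdeal R) R] [CharP (ResidueField R) p]
    [PerfectField (ResidueField R)] :
    ∃! ι : WittVector p (ResidueField R) →+* R, ∀ x, residue R (ι x) = x.coeff 0 := by
  have := isAdicComplete_span_p p R
  have hpm : (p : R) ∈ maximalIdeal R := by
    rw [← residue_eq_zero_iff, map_natCast, CharP.cast_eq_zero]
  have : Fact ¬ IsUnit (p : R) := ⟨(mem_maximalIdeal _).mp hpm⟩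
  have : ExpChar (ResidueField R) p := ExpChar.prime Fact.out
  have : CharP (R ⧸ maximalIdeal R) p := inferInstanceAs (CharP (ResidueField R) p)
  have : CharP (R ⧸ Ideal.span {(p : R)}) p := inferInstanceAs (CharP (ModP R p) p)
  have hle : Ideal.span {(p : R)} ≤ maximalIdeal R := by
    rw [Ideal.span_le]; simpa using hpm
  apply existsUnique_of_exists_of_unique
  · let q : ModP R p →+* ResidueField R := Ideal.Quotient.factor hle
    let F : PreTilt R p →+* Perfection (ResidueField R) p := Perfection.map p q
    have hF : Function.Bijective F := by
      have h : ⇑F = (Perfection.quotientMulEquiv p (maximalIdeal R)) ∘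
          (Perfection.quotientMulEquiv p (Ideal.span {(p : R)})).symm := by
        funext x
        obtain ⟨y, rfl⟩ := (Perfection.quotientMulEquiv p (Ideal.span {(p : R)})).surjective x
        simp only [Function.comp_apply, MulEquiv.symm_apply_apply]
        rfl
      rw [h]
      exact (MulEquiv.bijective _).comp (MulEquiv.bijective _)
    let G := RingEquiv.ofBijective F hF
    let j : ResidueField R →+* PreTilt R p :=
      (G.symm : _ →+* _).comp
        (Perfection.lift p (ResidueField R) (ResidueField R) (RingHom.id _))
    refine ⟨(WittVector.fontaineTheta R p).comp (WittVector.map j), fun x => ?_⟩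
    have h1 : residue R (WittVector.fontaineTheta R p (WittVector.map j x)) =
        q (Ideal.Quotient.mk _ (WittVector.fontaineTheta R p (WittVector.map j x))) := rfl
    rw [RingHom.comp_apply, h1, WittVector.mk_fontaineTheta, WittVector.map_coeff]
    have h2 : ∀ y : PreTilt R p, q (PreTilt.coeff 0 y) = Perfection.coeff _ p 0 (F y) :=
      fun y => rfl
    rw [h2]
    have h3 : F (j (x.coeff 0)) = Perfection.lift p (ResidueField R) (ResidueField R)
        (RingHom.id _) (x.coeff 0) := G.apply_symm_apply _
    rw [h3]
    rfl
  · intro f g hf hg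
    have key : ∀ n, (Ideal.Quotient.mk (maximalIdeal R ^ n)).comp f =
        (Ideal.Quotient.mk (maximalIdeal R ^ n)).comp g := by
      intro n
      apply WittVector.eq_of_apply_teichmuller_eq
      · refine ⟨n, ?_⟩
        rw [← map_natCast (Ideal.Quotient.mk (maximalIdeal R ^ n)), ← map_pow,
          Ideal.Quotient.eq_zero_iff_mem]
        exact Ideal.pow_mem_pow hpm n
      · intro a
        let b := ((frobeniusEquiv (ResidueField R) p).symm)^[n] a
        have hb : b ^ p ^ n = a := by
          rw [← iterate_frobenius]
          exact Function.RightInverse.iterate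
            (frobenius_apply_frobeniusEquiv_symm (ResidueField R) p) n a
        have h : f (WittVector.teichmuller p b) ≡ g (WittVector.teichmuller p b)
            [SMOD maximalIdeal R] := by
          rw [SModEq.idealQuotientMk]
          exact (hf _).trans (hg _).symm
        have h4 := (SModEq.pow_pow_add_one (Ideal.natCast_mem_of_charP_quotient p _) (m := n) h).mono
          (Ideal.pow_le_pow_right (Nat.le_succ n))
        rw [SModEq.idealQuotientMk, ← map_pow f, ← map_pow g, ← map_pow, hb] at h4
        exact h4
    ext x
    refine (IsHausdorff.eq_iff_smodEq (I := maximalIdeal R)).mpr fun n => ?_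
    rw [smul_eq_mul, Ideal.mul_top, SModEq.idealQuotientMk]
    exact RingHom.congr_fun (key n) x

/-- The canonical embedding `W(k) → R` of the ring of Witt vectors of the residue field `k`. -/
def wittHom (p : ℕ) [Fact p.Prime] (R : Type*) [CommRing R]
    [IsDomain R] [IsDiscreteValuationRing R] [CharZero R]
    [IsAdicComplete (maximalIdeal R) R] [CharP (ResidueField R) p]
    [PerfectField (ResidueField R)] : WittVector p (ResidueField R) →+* R :=
  (existsUnique_wittHom p R).choose

/-- The fraction field `K` of `W(k)`, as a subfield of the fraction field `L` of `R`. -/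
def wittField (p : ℕ) [Fact p.Prime] (R : Type*) [CommRing R]
    [IsDomain R] [IsDiscreteValuationRing R] [CharZero R]
    [IsAdicComplete (maximalIdeal R) R] [CharP (ResidueField R) p]
    [PerfectField (ResidueField R)] : Subfield (FractionRing R) :=
  Subfield.closure (Set.range ((algebraMap R (FractionRing R)).comp (wittHom p R)))

/-- The algebraic closure `L^alg` of the fraction field `L` of `R`. -/
abbrev FracAlg (R : Type*) [CommRing R] [IsDomain R] : Type _ :=
  AlgebraicClosure (FractionRing R)

/-- `ν(p)`, the absolute ramification index: the normalized (`ν(π) = 1`) valuation of `p`. -/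
def ramIdx (p : ℕ) (R : Type*) [CommRing R] [IsDomain R] [IsDiscreteValuationRing R] : ℕ :=
  (IsDiscreteValuationRing.addVal R (p : R)).toNat

/-- The additive valuation `ν : L → ℤ` with `ν(π) = 1`, for nonzero arguments (the value at `0`
is irrelevant). -/
def fracVal (R : Type*) [CommRing R] [IsDomain R] [IsDiscreteValuationRing R]
    (x : FractionRing R) : ℤ :=
  -WithZero.log ((IsDiscreteValuationRing.maximalIdeal R).valuation (FractionRing R) x)

/-- The valuation `ν̃` on `L^alg`: the unique extension of `ν / ν(p)`, which for the complete
field `L` is `ν̃(x) = ν(N(x)) / (d ν(p))`, where `N` is the norm from `L(x)` to `L` and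
`d = [L(x) : L]`; up to sign `N(x)` is the constant coefficient of the minimal polynomial. -/
def algVal (p : ℕ) (R : Type*) [CommRing R] [IsDomain R] [IsDiscreteValuationRing R]
    (x : FracAlg R) : EReal :=
  open Classical in
  if x = 0 then ⊤
  else (((fracVal R ((minpoly (FractionRing R) x).coeff 0) : ℝ) /
    ((minpoly (FractionRing R) x).natDegree * ramIdx p R) : ℝ) : EReal)

/-- The inclusion of `R` in `L^alg`. -/
def toAlg (R : Type*) [CommRing R] [IsDomain R] : R →+* FracAlg R :=
  (algebraMap (FractionRing R) (FracAlg R)).comp (algebraMap R (FractionRing R))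

/-- `M(R)_π`, the maximum of `ν̃(π - σ(π))` over the `K`-embeddings `σ : L → L^alg` with
`σ(π) ≠ π`. This is a finite set; the maximum of the empty set (the case `ν(p) = 1`)
is `-∞`. -/
def krasnerBound (p : ℕ) [Fact p.Prime] {R : Type*} [CommRing R]
    [IsDomain R] [IsDiscreteValuationRing R] [CharZero R]
    [IsAdicComplete (maximalIdeal R) R] [CharP (ResidueField R) p]
    [PerfectField (ResidueField R)] (π : R) : EReal :=
  sSup {t : EReal | ∃ σ : FractionRing R →ₐ[wittField p R] FracAlg R,
    σ (algebraMap R (FractionRing R) π) ≠ toAlg R π ∧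
    t = algVal p R (toAlg R π - σ (algebraMap R (FractionRing R) π))}

/-- The `n`-th residue ring `R / 𝔪ⁿ`. -/
abbrev ResRing (R : Type*) [CommRing R] [IsLocalRing R] (n : ℕ) : Type _ :=
  R ⧸ (maximalIdeal R ^ n)

/-- The projection `R / 𝔪ⁿ → R / 𝔪 = k`, for `n ≥ 1`. -/
def resProj (R : Type*) [CommRing R] [IsLocalRing R] (n : ℕ) [NeZero n] :
    ResRing R n →+* ResidueField R :=
  Ideal.Quotient.factor (Ideal.pow_le_self (NeZero.ne n))

/-- The reduction `k₁ → k₂` of a homomorphism `φ : R₁ / 𝔪₁^n₁ → R₂ / 𝔪₂^n₂`. -/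
def redHom {R₁ R₂ : Type*} [CommRing R₁] [IsLocalRing R₁] [CommRing R₂] [IsLocalRing R₂]
    {n₁ n₂ : ℕ} [NeZero n₂] (φ : ResRing R₁ n₁ →+* ResRing R₂ n₂) :
    ResidueField R₁ →+* ResidueField R₂ :=
  Ideal.Quotient.lift (maximalIdeal R₁)
    (((resProj R₂ n₂).comp φ).comp (Ideal.Quotient.mk (maximalIdeal R₁ ^ n₁)))
    (fun x hx => by
      have h : Ideal.Quotient.mk (maximalIdeal R₁ ^ n₁) x ^ n₁ = 0 := by
        rw [← map_pow, Ideal.Quotient.eq_zero_iff_mem]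
        exact Ideal.pow_mem_pow hx n₁
      have h' : (((resProj R₂ n₂).comp φ).comp (Ideal.Quotient.mk (maximalIdeal R₁ ^ n₁))) x ^ n₁
          = 0 := by
        rw [RingHom.comp_apply, ← map_pow, h, map_zero]
      exact eq_zero_of_pow_eq_zero h')

/-- `g : R₁ → R₂` is an `(n₁, n₂)`-lifting of `φ : R₁ / 𝔪₁^n₁ → R₂ / 𝔪₂^n₂` at the
uniformizer `π₁`. In the first condition, `σ` runs through the `K₂`-embeddings `L₂ → L₂^alg`, and
the supremum is over a finite set (again the maximum of the empty set is `-∞`). -/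
structure IsLiftingAt (p : ℕ) [Fact p.Prime] {R₁ R₂ : Type*} [CommRing R₁] [IsLocalRing R₁]
    [CommRing R₂] [IsDomain R₂] [IsDiscreteValuationRing R₂] [CharZero R₂]
    [IsAdicComplete (maximalIdeal R₂) R₂] [CharP (ResidueField R₂) p]
    [PerfectField (ResidueField R₂)] {n₁ n₂ : ℕ} [NeZero n₂]
    (φ : ResRing R₁ n₁ →+* ResRing R₂ n₂) (π₁ : R₁) (g : R₁ →+* R₂) : Prop where
  exists_representative : ∃ β : R₂,
    Ideal.Quotient.mk (maximalIdeal R₂ ^ n₂) β =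
      φ (Ideal.Quotient.mk (maximalIdeal R₁ ^ n₁) π₁) ∧
    sSup {t : EReal | ∃ σ : FractionRing R₂ →ₐ[wittField p R₂] FracAlg R₂,
      σ (algebraMap R₂ (FractionRing R₂) (g π₁)) ≠ toAlg R₂ (g π₁) ∧
      t = algVal p R₂ (σ (algebraMap R₂ (FractionRing R₂) (g π₁)) - toAlg R₂ β)} <
    algVal p R₂ (toAlg R₂ (g π₁) - toAlg R₂ β)
  red_comp_residue : (redHom φ).comp (residue R₁) = (residue R₂).comp g

end ResidueLifting

end

noncomputable section

namespace ResidueLifting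

open scoped NNReal

/-! Normalize absolute values so that |p| = 1/p; every homomorphism `R → S` then extends to an
isometry of algebraic closures. By the isosceles principle the lifting condition at π says that
|g(π) - β| is smaller than the distance from g(π) to each of its other conjugates. That condition
depends on the source alone. A uniformizer π is a root of a monic polynomial over `W(k)` of degree e
= ν(p), and g(π) has degree at least e over the Witt field of the target, because |g(π)|^e = 1/p
while that field has value group p^ℤ. So the conjugates of g(π) are the images of those of π
(`exists_algHom_apply_eq_iff`, `ltConjDist_iff_map`). The choice of π is also immaterial: R =
W(k)[π], and polynomials with integral coefficients are 1-Lipschitz on the unit ball. For the same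
reason a lifting is close to φ at every element of R
(`IsLiftingAt.exists_representative_of_irreducible`). For the composition, approximate g₁₂(ϖ) by β
and g₂₃(β) by γ; the ultrametric inequality bounds |g(ϖ) - γ|. The two bounds are comparable because
equal ramification makes g₁₂ send uniformizers to uniformizers (`ltConjDist_iff_of_ramIdx_eq`). For
uniqueness, the bound on n₃ makes two representatives close, so another lifting h has h(ϖ) close to
g(ϖ). As h(ϖ) is a conjugate of g(ϖ), the two coincide (`eq_of_ltConjDist`). -/

theorem natCast_mem_maximalIdeal (p : ℕ) (R : Type*) [CommRing R] [IsLocalRing R]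
    [CharP (ResidueField R) p] : (p : R) ∈ maximalIdeal R := by
  rw [← residue_eq_zero_iff, map_natCast, CharP.cast_eq_zero]

theorem natCast_prime_ne_zero (p : ℕ) [Fact p.Prime] (R : Type*) [CommRing R] [CharZero R] :
    (p : R) ≠ 0 := by
  exact_mod_cast (Fact.out : p.Prime).ne_zero

theorem addVal_natCast_prime (p : ℕ) [Fact p.Prime] (R : Type*) [CommRing R] [IsDomain R]
    [IsDiscreteValuationRing R] [CharZero R] :
    IsDiscreteValuationRing.addVal R (p : R) = ramIdx p R := by
  have h : IsDiscreteValuationRing.addVal R (p : R) ≠ ⊤ := by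
    rw [Ne, IsDiscreteValuationRing.addVal_eq_top_iff]
    exact natCast_prime_ne_zero p R
  exact (ENat.natCast_toNat h).symm

theorem exists_natCast_eq_unit_mul_pow (p : ℕ) [Fact p.Prime] {R : Type*} [CommRing R]
    [IsDomain R] [IsDiscreteValuationRing R] [CharZero R] {π : R} (hπ : Irreducible π) :
    ∃ u : Rˣ, (p : R) = u * π ^ ramIdx p R := by
  obtain ⟨n, u, hu⟩ :=
    IsDiscreteValuationRing.eq_unit_mul_pow_irreducible (natCast_prime_ne_zero p R) hπ
  have h := addVal_natCast_prime p R
  rw [hu, IsDiscreteValuationRing.addVal_def' u hπ, Nat.cast_inj] at h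
  exact ⟨u, by rw [← h, ← hu]⟩

/-! ### The absolute value on the fraction field with |p| = 1/p -/

section Ramification

variable (p : ℕ) [Fact p.Prime] (R : Type*) [CommRing R] [IsDomain R] [IsDiscreteValuationRing R]
  [CharZero R] [CharP (ResidueField R) p]

theorem ramIdx_pos : 0 < ramIdx p R := by
  refine Nat.pos_of_ne_zero fun h => ?_
  have h1 := addVal_natCast_prime p R
  rw [h, Nat.cast_zero, IsDiscreteValuationRing.addVal_eq_zero_iff] at h1
  exact (mem_maximalIdeal _).mp (natCast_mem_maximalIdeal p R) h1

/-- The absolute value of the inverse of a uniformizer when `p` has absolute value `1 / p`. -/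
def absBase : ℝ≥0 := (p : ℝ≥0) ^ (1 / (ramIdx p R : ℝ))

theorem one_lt_absBase : 1 < absBase p R := by
  refine NNReal.one_lt_rpow (by exact_mod_cast (Fact.out : p.Prime).one_lt) ?_
  have := ramIdx_pos p R
  positivity

theorem absBase_pow_ramIdx : (absBase p R : ℝ) ^ ramIdx p R = p := by
  have h : (ramIdx p R : ℝ) ≠ 0 := by exact_mod_cast (ramIdx_pos p R).ne'
  rw [absBase, ← NNReal.coe_pow, ← NNReal.rpow_natCast, ← NNReal.rpow_mul,
    one_div_mul_cancel h]
  simp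

theorem log_absBase : Real.log (absBase p R) = Real.log p / ramIdx p R := by
  have h : (ramIdx p R : ℝ) ≠ 0 := by exact_mod_cast (ramIdx_pos p R).ne'
  rw [← absBase_pow_ramIdx p R, Real.log_pow, mul_div_cancel_left₀ _ h]

/-- The absolute value on the fraction field of `R` for which `p` has absolute value `1 / p`. -/
def fieldAbs : AbsoluteValue (FractionRing R) ℝ :=
  (IsDiscreteValuationRing.maximalIdeal R).adicAbv (one_lt_absBase p R)

theorem isNonarchimedean_fieldAbs : IsNonarchimedean (fieldAbs p R) :=
  IsDedekindDomain.HeightOneSpectrum.isNonarchimedean_adicAbv _ _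

theorem toNNReal_exp {b : ℝ≥0} (hb : b ≠ 0) (n : ℤ) :
    WithZeroMulInt.toNNReal hb (WithZero.exp n) = b ^ n := by
  rw [WithZeroMulInt.toNNReal_neg_apply hb WithZero.exp_ne_zero]
  rfl

theorem fieldAbs_eq_zpow {x : FractionRing R} (hx : x ≠ 0) :
    fieldAbs p R x = (absBase p R : ℝ) ^ (-fracVal R x) := by
  have h : (IsDiscreteValuationRing.maximalIdeal R).valuation (FractionRing R) x ≠ 0 :=
    (Valuation.ne_zero_iff _).mpr hx
  rw [fracVal, neg_neg, ← NNReal.coe_zpow, ← toNNReal_exp (one_lt_absBase p R).ne_zero,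
    WithZero.exp_log h]
  rfl

variable {R} in
theorem fieldAbs_le_iff_mem (r : R) (n : ℕ) :
    fieldAbs p R (algebraMap R _ r) ≤ (absBase p R : ℝ)⁻¹ ^ n ↔ r ∈ maximalIdeal R ^ n := by
  have h := IsDedekindDomain.HeightOneSpectrum.intValuation_le_pow_iff_mem
    (IsDiscreteValuationRing.maximalIdeal R) r n
  have h2 := (WithZeroMulInt.toNNReal_strictMono (one_lt_absBase p R)).le_iff_le
    (a := (IsDiscreteValuationRing.maximalIdeal R).intValuation r) (b := WithZero.exp (-(n : ℤ)))
  refine Iff.trans ?_ h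
  rw [← h2, toNNReal_exp, ← IsDedekindDomain.HeightOneSpectrum.valuation_of_algebraMap
    (K := FractionRing R), ← NNReal.coe_le_coe, NNReal.coe_zpow, zpow_neg, zpow_natCast, inv_pow]
  rfl

variable {R}

theorem fieldAbs_le_one (r : R) : fieldAbs p R (algebraMap R _ r) ≤ 1 := by
  simpa using (fieldAbs_le_iff_mem p r 0).mpr (by simp)

theorem fieldAbs_unit (u : Rˣ) : fieldAbs p R (algebraMap R _ u) = 1 := by
  refine le_antisymm (fieldAbs_le_one p _) ?_
  have h1 := fieldAbs_le_one p (↑u⁻¹ : R)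
  have h2 : fieldAbs p R (algebraMap R _ u) * fieldAbs p R (algebraMap R _ (↑u⁻¹ : R)) = 1 := by
    rw [← map_mul, ← map_mul, Units.mul_inv, map_one, map_one]
  nlinarith [(fieldAbs p R).nonneg (algebraMap R _ (u : R))]

theorem fieldAbs_natCast : fieldAbs p R (p : FractionRing R) = (p : ℝ)⁻¹ := by
  obtain ⟨π, hπ⟩ := IsDiscreteValuationRing.exists_irreducible R
  have hmem : algebraMap R (FractionRing R) π ≠ 0 := by
    simpa using hπ.ne_zero
  have h1 : fieldAbs p R (algebraMap R _ π) = (absBase p R : ℝ)⁻¹ := by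
    have h := IsDedekindDomain.HeightOneSpectrum.intValuation_singleton
      (IsDiscreteValuationRing.maximalIdeal R) hπ.ne_zero
      (hπ.maximalIdeal_eq)
    rw [← zpow_neg_one, ← NNReal.coe_zpow, ← toNNReal_exp (one_lt_absBase p R).ne_zero, ← h,
      ← IsDedekindDomain.HeightOneSpectrum.valuation_of_algebraMap (K := FractionRing R)]
    rfl
  obtain ⟨u, hu⟩ := exists_natCast_eq_unit_mul_pow p hπ
  have h2 : (p : FractionRing R) = algebraMap R _ (p : R) := (map_natCast _ _).symm
  rw [h2, hu, map_mul, map_mul, fieldAbs_unit, one_mul, map_pow, map_pow, h1, inv_pow,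
    absBase_pow_ramIdx]

variable (R) in
/-- The fraction field of `R` as a normed field. -/
@[reducible] def fracNormedField : NontriviallyNormedField (FractionRing R) where
  __ := (fieldAbs p R).toNormedField
  non_trivial := by
    refine ⟨(p : FractionRing R)⁻¹, ?_⟩
    change 1 < fieldAbs p R (p : FractionRing R)⁻¹
    rw [map_inv₀, fieldAbs_natCast, inv_inv]
    exact_mod_cast (Fact.out : p.Prime).one_lt

end Ramification

/-! ### Completeness and the extension to the algebraic closure -/

section Complete

variable (p : ℕ) [Fact p.Prime] (R : Type*) [CommRing R] [IsDomain R] [IsDiscreteValuationRing R]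
  [CharZero R] [CharP (ResidueField R) p]

theorem isUltrametricDist_frac :
    letI := fracNormedField p R
    IsUltrametricDist (FractionRing R) :=
  let := fracNormedField p R
  IsUltrametricDist.isUltrametricDist_of_isNonarchimedean_norm (isNonarchimedean_fieldAbs p R)

theorem exists_algebraMap_of_fieldAbs_le_one {x : FractionRing R} (hx : fieldAbs p R x ≤ 1) :
    ∃ r : R, algebraMap R _ r = x := by
  have h := (WithZeroMulInt.toNNReal_le_one_iff (one_lt_absBase p R)
    (m := (IsDiscreteValuationRing.maximalIdeal R).valuation (FractionRing R) x)).mp hx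
  exact IsDiscreteValuationRing.exists_lift_of_le_one h

variable [IsAdicComplete (maximalIdeal R) R]

/-- Along a subsequence whose n-th step is smaller than |π|^n, the steps lie in 𝔪^n, so their
partial sums converge 𝔪-adically in R. -/
theorem completeSpace_frac :
    letI := fracNormedField p R
    CompleteSpace (FractionRing R) := by
  let := fracNormedField p R
  have hnorm : ∀ x : FractionRing R, ‖x‖ = fieldAbs p R x := fun _ => rfl
  have hb0 : 0 < (absBase p R : ℝ)⁻¹ :=
    inv_pos.mpr (zero_lt_one.trans (by exact_mod_cast one_lt_absBase p R))
  have hb1 : (absBase p R : ℝ)⁻¹ < 1 := inv_lt_one_of_one_lt₀ (by exact_mod_cast one_lt_absBase p R)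
  refine Metric.complete_of_cauchySeq_tendsto fun u hu => ?_
  obtain ⟨f, hf, hfu⟩ := hu.subseq_mem
    (V := fun n => {q | dist q.1 q.2 < (absBase p R : ℝ)⁻¹ ^ n})
    (fun n => Metric.dist_mem_uniformity (pow_pos hb0 n))
  have hstep : ∀ n, ∃ r : R, r ∈ maximalIdeal R ^ n ∧
      algebraMap R _ r = u (f (n + 1)) - u (f n) := by
    intro n
    have h : fieldAbs p R (u (f (n + 1)) - u (f n)) < (absBase p R : ℝ)⁻¹ ^ n := by
      rw [← hnorm, ← dist_eq_norm]
      exact hfu n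
    obtain ⟨r, hr⟩ := exists_algebraMap_of_fieldAbs_le_one p R
      (h.le.trans (pow_le_one₀ hb0.le hb1.le))
    exact ⟨r, (fieldAbs_le_iff_mem p r n).mp (by rw [hr]; exact h.le), hr⟩
  choose r hrm hr using hstep
  have hsum : ∀ n, algebraMap R _ (∑ i ∈ Finset.range n, r i) = u (f n) - u (f 0) := by
    intro n
    rw [map_sum, Finset.sum_congr rfl fun i _ => hr i, Finset.sum_range_sub (fun i => u (f i))]
  obtain ⟨s, hs⟩ := IsPrecomplete.prec (I := maximalIdeal R) (M := R) inferInstance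
    (f := fun n => ∑ i ∈ Finset.range n, r i) (fun {m n} hmn => by
      rw [smul_eq_mul, Ideal.mul_top, SModEq.comm, SModEq.sub_mem,
        ← Finset.sum_Ico_eq_sub _ hmn]
      refine Ideal.sum_mem _ fun i hi => ?_
      exact Ideal.pow_le_pow_right (Finset.mem_Ico.mp hi).1 (hrm i))
  refine ⟨algebraMap R _ s + u (f 0), tendsto_nhds_of_cauchySeq_of_subseq hu hf.tendsto_atTop ?_⟩
  refine tendsto_iff_dist_tendsto_zero.mpr (squeeze_zero (fun _ => dist_nonneg) (fun n => ?_)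
    (tendsto_pow_atTop_nhds_zero_of_lt_one hb0.le hb1))
  have h := hs n
  rw [smul_eq_mul, Ideal.mul_top, SModEq.sub_mem] at h
  have h2 := (fieldAbs_le_iff_mem p _ n).mpr h
  rw [map_sub, hsum] at h2
  rw [dist_eq_norm, hnorm]
  convert h2 using 2
  simp only [Function.comp_apply]
  ring

/-- The absolute value on the algebraic closure of the fraction field of `R`, with `|p| = 1 / p`. -/
def algAbs : AbsoluteValue (FracAlg R) ℝ :=
  letI := fracNormedField p R
  haveI := isUltrametricDist_frac p R
  haveI := completeSpace_frac p R
  { toFun := spectralNorm (FractionRing R) (FracAlg R)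
    map_mul' := (spectralMulAlgNorm (FractionRing R) (FracAlg R)).map_mul'
    nonneg' := spectralNorm_nonneg
    eq_zero' := fun x => ⟨(spectralMulAlgNorm (FractionRing R) (FracAlg R)).eq_zero_of_map_eq_zero' x,
      fun h => by rw [h]; exact spectralNorm_zero⟩
    add_le' := (spectralMulAlgNorm (FractionRing R) (FracAlg R)).add_le' }

theorem isNonarchimedean_algAbs : IsNonarchimedean (algAbs p R) :=
  let := fracNormedField p R
  have := isUltrametricDist_frac p R
  isNonarchimedean_spectralNorm (K := FractionRing R) (L := FracAlg R)

theorem algAbs_algebraMap (x : FractionRing R) :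
    algAbs p R (algebraMap _ _ x) = fieldAbs p R x :=
  let := fracNormedField p R
  spectralNorm_extends x

/-- Uniqueness of the extension over a complete field; it makes extended homomorphisms isometric. -/
theorem eq_algAbs_of_extends (f : AbsoluteValue (FracAlg R) ℝ)
    (hf : ∀ x : FractionRing R, f (algebraMap _ _ x) = fieldAbs p R x) : f = algAbs p R := by
  let := fracNormedField p R
  have := isUltrametricDist_frac p R
  have := completeSpace_frac p R
  ext x
  exact spectralNorm_unique_field_norm_ext hf x

-- The spectral norm of x is the d-th root of the absolute value of the constant coefficient of its
-- minimal polynomial, d being the degree, which is the formula defining `algVal`.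
variable {R} in
theorem algVal_eq_neg_log {x : FracAlg R} (hx : x ≠ 0) :
    algVal p R x = ((-Real.log (algAbs p R x) / Real.log p : ℝ) : EReal) := by
  let := fracNormedField p R
  have := isUltrametricDist_frac p R
  have := completeSpace_frac p R
  have hint : IsIntegral (FractionRing R) x := (Algebra.IsAlgebraic.isAlgebraic x).isIntegral
  have h0 : (minpoly (FractionRing R) x).coeff 0 ≠ 0 := minpoly.coeff_zero_ne_zero hint hx
  have h1 : algAbs p R x = fieldAbs p R ((minpoly (FractionRing R) x).coeff 0) ^
      (1 / (minpoly (FractionRing R) x).natDegree : ℝ) :=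
    spectralNorm.spectralNorm_eq_norm_coeff_zero_rpow _ _ x
  have h2 : Real.log p ≠ 0 := (Real.log_pos (by exact_mod_cast (Fact.out : p.Prime).one_lt)).ne'
  have h3 : ((minpoly (FractionRing R) x).natDegree : ℝ) ≠ 0 := by
    exact_mod_cast (minpoly.natDegree_pos hint).ne'
  have h4 : (ramIdx p R : ℝ) ≠ 0 := by exact_mod_cast (ramIdx_pos p R).ne'
  rw [algVal, if_neg hx, h1, Real.log_rpow ((fieldAbs p R).pos h0), fieldAbs_eq_zpow p R h0,
    Real.log_zpow, log_absBase]
  congr 1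
  push_cast
  field_simp

variable {R} in
theorem algVal_lt_algVal_iff (x y : FracAlg R) :
    algVal p R x < algVal p R y ↔ algAbs p R y < algAbs p R x := by
  have h2 : 0 < Real.log p := Real.log_pos (by exact_mod_cast (Fact.out : p.Prime).one_lt)
  by_cases hx : x = 0
  · simp only [algVal, hx, if_true, map_zero, not_top_lt, false_iff, not_lt]
    exact (algAbs p R).nonneg y
  · rw [algVal_eq_neg_log p hx]
    by_cases hy : y = 0
    · simp only [hy, algVal, if_true, map_zero, (algAbs p R).pos hx, iff_true]
      exact EReal.coe_lt_top _
    · rw [algVal_eq_neg_log p hy, EReal.coe_lt_coe_iff, div_lt_div_iff_of_pos_right h2,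
        neg_lt_neg_iff, Real.log_lt_log_iff ((algAbs p R).pos hy) ((algAbs p R).pos hx)]

end Complete

/-! ### Homomorphisms out of Witt vectors are determined by residues -/

section WittHom

variable {p : ℕ} [Fact p.Prime]

/-- Two ring homomorphisms from the Witt vectors of a perfect ring agree as soon as they agree
modulo a nilpotent ideal containing `p`. -/
theorem wittVector_hom_ext_of_nilpotent {k T : Type*} [CommRing k] [CharP k p] [PerfectRing k p]
    [CommRing T] {J : Ideal T} {n : ℕ} (hJ : J ^ n = ⊥) (hp : (p : T) ∈ J)
    {f g : WittVector p k →+* T} (h : ∀ x, f x - g x ∈ J) : f = g := by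
  apply WittVector.eq_of_apply_teichmuller_eq
  · refine ⟨n, ?_⟩
    rw [← Ideal.mem_bot, ← hJ]
    exact Ideal.pow_mem_pow hp n
  · intro a
    -- A p^n-th root of a: raising a congruence modulo J to the p^n-th power improves it to one
    -- modulo J^(n+1), hence to an equality.
    let b := ((frobeniusEquiv k p).symm)^[n] a
    have hb : b ^ p ^ n = a := by
      rw [← iterate_frobenius]
      exact Function.RightInverse.iterate (frobenius_apply_frobeniusEquiv_symm k p) n a
    have h1 : f (WittVector.teichmuller p b) ≡ g (WittVector.teichmuller p b) [SMOD J] :=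
      SModEq.sub_mem.mpr (h _)
    have h4 := (SModEq.pow_pow_add_one hp (m := n) h1).mono
      (Ideal.pow_le_pow_right (Nat.le_succ n))
    rw [← map_pow f, ← map_pow g, ← map_pow, hb, hJ, SModEq.bot] at h4
    exact h4

/-- In each quotient by 𝔪^n the image of 𝔪 is nilpotent and contains p; separatedness of R then
passes to the limit. -/
theorem wittVector_hom_ext {k R : Type*} [CommRing k] [CharP k p] [PerfectRing k p]
    [CommRing R] [IsLocalRing R] [IsHausdorff (maximalIdeal R) R] [CharP (ResidueField R) p]
    {f g : WittVector p k →+* R} (h : ∀ x, residue R (f x) = residue R (g x)) : f = g := by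
  ext x
  refine (IsHausdorff.eq_iff_smodEq (I := maximalIdeal R)).mpr fun n => ?_
  rw [smul_eq_mul, Ideal.mul_top, SModEq.idealQuotientMk]
  refine RingHom.congr_fun (f := (Ideal.Quotient.mk (maximalIdeal R ^ n)).comp f)
    (g := (Ideal.Quotient.mk (maximalIdeal R ^ n)).comp g)
    (wittVector_hom_ext_of_nilpotent
      (J := (maximalIdeal R).map (Ideal.Quotient.mk (maximalIdeal R ^ n))) (n := n) ?_ ?_ ?_) x
  · rw [← Ideal.map_pow, Ideal.map_quotient_self]
  · rw [← map_natCast (Ideal.Quotient.mk (maximalIdeal R ^ n))]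
    exact Ideal.mem_map_of_mem _ (natCast_mem_maximalIdeal p R)
  · intro y
    rw [RingHom.comp_apply, RingHom.comp_apply, ← map_sub]
    refine Ideal.mem_map_of_mem _ ?_
    rw [← residue_eq_zero_iff, map_sub, h, sub_self]

end WittHom

instance perfectRing_of_perfectField (p : ℕ) [Fact p.Prime] (k : Type*) [Field k] [CharP k p]
    [PerfectField k] : PerfectRing k p :=
  haveI : ExpChar k p := ExpChar.prime Fact.out
  inferInstance

/-! ### R is generated by a uniformizer over W(k) -/

section Generators

variable (p : ℕ) [Fact p.Prime] {R : Type*} [CommRing R] [IsDomain R] [IsDiscreteValuationRing R]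
  [CharZero R] [IsAdicComplete (maximalIdeal R) R] [CharP (ResidueField R) p]
  [PerfectField (ResidueField R)]

theorem residue_wittHom (x : WittVector p (ResidueField R)) :
    residue R (wittHom p R x) = x.coeff 0 :=
  (existsUnique_wittHom p R).choose_spec.1 x

/-- Digit expansion: if the remainder is π^n c, the Teichmüller lift of the residue of c is the next
coefficient. -/
theorem exists_sub_sum_wittHom_mem {π : R} (hπ : Irreducible π) (n : ℕ) (x : R) :
    ∃ a : ℕ → WittVector p (ResidueField R),
      x - ∑ i ∈ Finset.range n, wittHom p R (a i) * π ^ i ∈ maximalIdeal R ^ n := by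
  induction n with
  | zero => exact ⟨0, by simp⟩
  | succ n ih =>
    obtain ⟨a, ha⟩ := ih
    rw [hπ.maximalIdeal_eq, Ideal.span_singleton_pow, Ideal.mem_span_singleton] at ha
    obtain ⟨c, hc⟩ := ha
    refine ⟨Function.update a n (WittVector.teichmuller p (residue R c)), ?_⟩
    rw [Finset.sum_range_succ, Function.update_self, Finset.sum_congr rfl fun i hi => by
      rw [Function.update_of_ne (Finset.mem_range.mp hi).ne], ← sub_sub, hc, mul_comm (π ^ n),
      ← sub_mul, mul_comm, pow_succ]
    refine Ideal.mul_mem_mul ?_ ?_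
    · rw [hπ.maximalIdeal_eq]
      exact Ideal.pow_mem_pow (Ideal.mem_span_singleton_self π) n
    · rw [← residue_eq_zero_iff, map_sub, residue_wittHom, WittVector.teichmuller_coeff_zero,
        sub_self]

/-- Limits are taken coordinatewise; since the ideal is principal, a^n factors out of the whole
vector of errors. -/
theorem isPrecomplete_pi {A ι : Type*} [CommRing A] [Fintype ι] (a : A)
    [IsPrecomplete (Ideal.span {a}) A] : IsPrecomplete (Ideal.span {a}) (ι → A) := by
  refine ⟨fun f hf => ?_⟩
  have hi : ∀ i, ∃ l : A, ∀ n, f n i ≡ l [SMOD (Ideal.span {a} ^ n • ⊤ : Ideal A)] := by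
    intro i
    refine IsPrecomplete.prec' (fun n => f n i) fun {m n} hmn => ?_
    have h := (hf hmn).map (LinearMap.proj i : (ι → A) →ₗ[A] A)
    rw [Submodule.map_smul''] at h
    exact h.mono (Submodule.smul_mono le_rfl le_top)
  choose l hl using hi
  refine ⟨l, fun n => ?_⟩
  have hd : ∀ i, ∃ c, f n i - l i = a ^ n * c := by
    intro i
    have h := hl i n
    rw [SModEq.sub_mem, smul_eq_mul, Ideal.mul_top, Ideal.span_singleton_pow,
      Ideal.mem_span_singleton] at h
    exact h
  choose c hc using hd
  rw [SModEq.sub_mem, show f n - l = a ^ n • c from funext hc]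
  exact Submodule.smul_mem_smul (Ideal.pow_mem_pow (Ideal.mem_span_singleton_self a) n) trivial

/-- `R` is generated over the image of `W(k)` by the first `ν(p)` powers of a uniformizer. -/
theorem exists_eq_sum_wittHom {π : R} (hπ : Irreducible π) (x : R) :
    ∃ a : Fin (ramIdx p R) → WittVector p (ResidueField R),
      x = ∑ i, wittHom p R (a i) * π ^ (i : ℕ) := by
  let : Algebra (WittVector p (ResidueField R)) R := (wittHom p R).toAlgebra
  let I : Ideal (WittVector p (ResidueField R)) := Ideal.span {(p : WittVector p (ResidueField R))}
  have hI : I.map (algebraMap (WittVector p (ResidueField R)) R) = Ideal.span {(p : R)} := by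
    rw [Ideal.map_span, Set.image_singleton, map_natCast]
  have hpre : IsPrecomplete I (Fin (ramIdx p R) → WittVector p (ResidueField R)) :=
    have := (WittVector.isAdicCompleteIdealSpanP (p := p) (k := ResidueField R)).toIsPrecomplete
    isPrecomplete_pi _
  have hhaus : IsHausdorff I R := by
    have h : IsHausdorff (I.map (algebraMap (WittVector p (ResidueField R)) R)) R := by
      rw [hI]
      exact (isAdicComplete_span_p p R).toIsHausdorff
    exact IsHausdorff.map_algebraMap_iff.mp h
  let f := Fintype.linearCombination (WittVector p (ResidueField R))
    (fun i : Fin (ramIdx p R) => π ^ (i : ℕ))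
  -- By completeness of the source and separatedness of R, surjectivity modulo p suffices; as p is a
  -- unit times π^e, this is the digit expansion of length e.
  have hf : Function.Surjective f := by
    refine surjective_of_mkQ_comp_surjective (I := I) fun z => ?_
    obtain ⟨y, rfl⟩ := Submodule.mkQ_surjective _ z
    obtain ⟨a, ha⟩ := exists_sub_sum_wittHom_mem p hπ (ramIdx p R) y
    refine ⟨fun i => a i, ?_⟩
    rw [LinearMap.comp_apply, ← sub_eq_zero, ← map_sub, Submodule.mkQ_apply,
      Submodule.Quotient.mk_eq_zero, ← neg_mem_iff, neg_sub, Ideal.smul_top_eq_map, hI]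
    obtain ⟨u, hu⟩ := exists_natCast_eq_unit_mul_pow p hπ
    rw [hπ.maximalIdeal_eq, Ideal.span_singleton_pow] at ha
    rw [Submodule.restrictScalars_mem, hu, Ideal.span_singleton_mul_left_unit u.isUnit]
    convert ha using 2
    rw [Fintype.linearCombination_apply, Finset.sum_range]
    rfl
  obtain ⟨a, ha⟩ := hf x
  refine ⟨a, ?_⟩
  rw [← ha, Fintype.linearCombination_apply]
  rfl

theorem exists_eval₂_wittHom_eq {π : R} (hπ : Irreducible π) (x : R) :
    ∃ A : Polynomial (WittVector p (ResidueField R)), A.eval₂ (wittHom p R) π = x := by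
  obtain ⟨a, ha⟩ := exists_eq_sum_wittHom p hπ x
  refine ⟨∑ i, Polynomial.C (a i) * Polynomial.X ^ (i : ℕ), ?_⟩
  simp [Polynomial.eval₂_finsetSum, ha]

/-- A uniformizer is a root of a monic polynomial of degree `ν(p)` with coefficients in `W(k)`. -/
theorem exists_monic_eval₂_wittHom_eq_zero {π : R} (hπ : Irreducible π) :
    ∃ F : Polynomial (WittVector p (ResidueField R)), F.Monic ∧ F.natDegree = ramIdx p R ∧
      F.eval₂ (wittHom p R) π = 0 := by
  obtain ⟨a, ha⟩ := exists_eq_sum_wittHom p hπ (π ^ ramIdx p R)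
  have hdeg : (∑ i, Polynomial.C (a i) * Polynomial.X ^ (i : ℕ)).degree < ((ramIdx p R : ℕ) : WithBot ℕ) :=
    Polynomial.degree_sum_fin_lt a
  refine ⟨Polynomial.X ^ ramIdx p R - ∑ i, Polynomial.C (a i) * Polynomial.X ^ (i : ℕ),
    Polynomial.monic_X_pow_sub hdeg, Polynomial.natDegree_eq_of_degree_eq_some ?_, ?_⟩
  · rw [Polynomial.degree_sub_eq_left_of_degree_lt (by rwa [Polynomial.degree_X_pow]),
      Polynomial.degree_X_pow]
  · simp [Polynomial.eval₂_finsetSum, ha]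

end Generators

/-! ### Homomorphisms between rings of mixed characteristic -/

/-- Every ring homomorphism between discrete valuation rings of mixed characteristic `(0, p)` is
local. -/
theorem isLocalHom_of_mixedChar (p : ℕ) [Fact p.Prime] {R S : Type*} [CommRing R] [IsDomain R]
    [IsDiscreteValuationRing R] [CharZero R] [CharP (ResidueField R) p]
    [CommRing S] [IsLocalRing S] [CharP (ResidueField S) p] (g : R →+* S) : IsLocalHom g := by
  refine ⟨fun x hx => ?_⟩
  by_contra hxm
  obtain ⟨π, hπ⟩ := IsDiscreteValuationRing.exists_irreducible R
  have h1 : x ∈ maximalIdeal R := hxm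
  rw [hπ.maximalIdeal_eq, Ideal.mem_span_singleton] at h1
  obtain ⟨u, hu⟩ := exists_natCast_eq_unit_mul_pow p hπ
  have h2 : (p : R) ∣ x ^ ramIdx p R := by
    rw [hu, Units.mul_left_dvd]
    exact pow_dvd_pow_of_dvd h1 _
  have h3 := map_dvd g h2
  rw [map_natCast, map_pow] at h3
  exact (mem_maximalIdeal _).mp (natCast_mem_maximalIdeal p S)
    (isUnit_of_dvd_unit h3 (hx.pow _))

/-- A nonzero element of the kernel is a unit times a power of π, so π and then p would be killed.
-/
theorem injective_of_mixedChar (p : ℕ) [Fact p.Prime] {R S : Type*} [CommRing R] [IsDomain R]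
    [IsDiscreteValuationRing R] [CharZero R] [CharP (ResidueField R) p]
    [CommRing S] [IsDomain S] [CharZero S] (g : R →+* S) : Function.Injective g := by
  rw [injective_iff_map_eq_zero]
  intro x hx
  by_contra hx0
  obtain ⟨π, hπ⟩ := IsDiscreteValuationRing.exists_irreducible R
  obtain ⟨n, u, hu⟩ := IsDiscreteValuationRing.eq_unit_mul_pow_irreducible hx0 hπ
  obtain ⟨v, hv⟩ := exists_natCast_eq_unit_mul_pow p hπ
  have h1 : g π = 0 := by
    rw [hu, map_mul, map_pow] at hx
    exact eq_zero_of_pow_eq_zero ((u.isUnit.map g).mul_right_eq_zero.mp hx)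
  have h2 := congrArg g hv
  rw [map_natCast, map_mul, map_pow, h1, zero_pow (ramIdx_pos p R).ne', mul_zero] at h2
  exact natCast_prime_ne_zero p S h2

section RingHom

variable (p : ℕ) [Fact p.Prime] {R S : Type*}
  [CommRing R] [IsDomain R] [IsDiscreteValuationRing R] [CharZero R] [CharP (ResidueField R) p]
  [IsAdicComplete (maximalIdeal R) R] [PerfectField (ResidueField R)]
  [CommRing S] [IsDomain S] [IsDiscreteValuationRing S] [CharP (ResidueField S) p]

/-- Functoriality: g on the Witt part and the Witt functor applied to the residue map of g have the
same residues. -/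
theorem map_wittHom [CharZero S] [IsAdicComplete (maximalIdeal S) S]
    [PerfectField (ResidueField S)] (g : R →+* S) (x : WittVector p (ResidueField R)) :
    ∃ y, g (wittHom p R x) = wittHom p S y := by
  have := isLocalHom_of_mixedChar p g
  refine ⟨WittVector.map (ResidueField.map g) x, RingHom.congr_fun
    (f := g.comp (wittHom p R)) (g := (wittHom p S).comp (WittVector.map (ResidueField.map g)))
    (wittVector_hom_ext fun z => ?_) x⟩
  rw [RingHom.comp_apply, RingHom.comp_apply, residue_wittHom, WittVector.map_coeff,
    ← residue_wittHom, ResidueField.map_residue]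

variable {p} in
theorem comp_wittHom_eq [IsAdicComplete (maximalIdeal S) S] {g h : R →+* S} (H : (residue S).comp g = (residue S).comp h) :
    g.comp (wittHom p R) = h.comp (wittHom p R) :=
  wittVector_hom_ext fun z => RingHom.congr_fun H (wittHom p R z)

/-- The residue condition alone forces φ and g to agree on the Witt part, so only the uniformizer
has to be controlled. -/
theorem residueRing_map_wittHom {m n : ℕ} [NeZero n] (φ : ResRing R m →+* ResRing S n)
    {g : R →+* S} (H : (redHom φ).comp (residue R) = (residue S).comp g)
    (x : WittVector p (ResidueField R)) :
    φ (Ideal.Quotient.mk _ (wittHom p R x)) = Ideal.Quotient.mk _ (g (wittHom p R x)) := by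
  refine RingHom.congr_fun (f := φ.comp ((Ideal.Quotient.mk _).comp (wittHom p R)))
    (g := (Ideal.Quotient.mk _).comp (g.comp (wittHom p R)))
    (wittVector_hom_ext_of_nilpotent
      (J := (maximalIdeal S).map (Ideal.Quotient.mk (maximalIdeal S ^ n))) (n := n) ?_ ?_ ?_) x
  · rw [← Ideal.map_pow, Ideal.map_quotient_self]
  · rw [← map_natCast (Ideal.Quotient.mk (maximalIdeal S ^ n))]
    exact Ideal.mem_map_of_mem _ (natCast_mem_maximalIdeal p S)
  · intro y
    obtain ⟨z, hz⟩ := Ideal.Quotient.mk_surjective (φ (Ideal.Quotient.mk _ (wittHom p R y)))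
    have h1 : residue S z = residue S (g (wittHom p R y)) := by
      have h2 := RingHom.congr_fun H (wittHom p R y)
      have h3 : (redHom φ).comp (residue R) (wittHom p R y) =
          resProj S n (φ (Ideal.Quotient.mk _ (wittHom p R y))) := rfl
      rw [h3, ← hz] at h2
      exact h2
    rw [RingHom.comp_apply, RingHom.comp_apply, ← hz, RingHom.comp_apply, ← map_sub]
    refine Ideal.mem_map_of_mem _ ?_
    rw [← residue_eq_zero_iff, map_sub, h1, RingHom.comp_apply, sub_self]

end RingHom

theorem exists_ringHom_algebraicClosure {K L : Type*} [Field K] [Field L] [IsAlgClosed L]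
    (f : K →+* L) : ∃ G : AlgebraicClosure K →+* L, ∀ x, G (algebraMap _ _ x) = f x := by
  let := f.toAlgebra
  let G : AlgebraicClosure K →ₐ[K] L := IsAlgClosed.lift
  exact ⟨G, G.commutes⟩

/-! ### Homomorphisms are isometric -/

section Extension

variable (p : ℕ) [Fact p.Prime] {R S : Type*}
  [CommRing R] [IsDomain R] [IsDiscreteValuationRing R] [CharZero R] [CharP (ResidueField R) p]
  [CommRing S] [IsDomain S] [IsDiscreteValuationRing S] [CharZero S] [CharP (ResidueField S) p]

omit [CharP (ResidueField R) p] in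
theorem fieldAbs_map_uniformizer_pow (g : R →+* S) {π : R} (hπ : Irreducible π) :
    fieldAbs p S (algebraMap S _ (g π)) ^ ramIdx p R = (p : ℝ)⁻¹ := by
  obtain ⟨u, hu⟩ := exists_natCast_eq_unit_mul_pow p hπ
  have h := congrArg (fun x => fieldAbs p S (algebraMap S _ (g x))) hu
  simp only [map_natCast, map_mul, map_pow, fieldAbs_natCast] at h
  rw [h, show g u = (Units.map (g : R →* S) u : Sˣ) from rfl, fieldAbs_unit, one_mul]

theorem fieldAbs_map (g : R →+* S) (x : R) :
    fieldAbs p S (algebraMap S _ (g x)) = fieldAbs p R (algebraMap R _ x) := by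
  by_cases hx : x = 0
  · simp [hx]
  obtain ⟨π, hπ⟩ := IsDiscreteValuationRing.exists_irreducible R
  obtain ⟨n, u, hu⟩ := IsDiscreteValuationRing.eq_unit_mul_pow_irreducible hx hπ
  -- Both sides are nonnegative e-th roots of 1/p, because g fixes p and preserves units.
  have h : fieldAbs p S (algebraMap S _ (g π)) = fieldAbs p R (algebraMap R _ π) :=
    (pow_left_inj₀ ((fieldAbs p S).nonneg _) ((fieldAbs p R).nonneg _)
      (ramIdx_pos p R).ne').mp ((fieldAbs_map_uniformizer_pow p g hπ).trans
        (fieldAbs_map_uniformizer_pow p (RingHom.id R) hπ).symm)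
  simp only [hu, map_mul, map_pow, h, fieldAbs_unit]
  rw [show g u = (Units.map (g : R →* S) u : Sˣ) from rfl, fieldAbs_unit]

variable [IsAdicComplete (maximalIdeal R) R] [IsAdicComplete (maximalIdeal S) S]

/-- A ring homomorphism `R → S` extends to the algebraic closures of the fraction fields, and the
extension preserves absolute values. -/
theorem exists_extension_algAbs (g : R →+* S) :
    ∃ G : FracAlg R →+* FracAlg S, G.comp (toAlg R) = (toAlg S).comp g ∧
      ∀ x, algAbs p S (G x) = algAbs p R x := by
  have hinj : Function.Injective ((algebraMap S (FractionRing S)).comp g) :=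
    (IsFractionRing.injective S (FractionRing S)).comp (injective_of_mixedChar p g)
  let gL : FractionRing R →+* FractionRing S := IsFractionRing.lift hinj
  have hgL : ∀ r, gL (algebraMap R _ r) = algebraMap S _ (g r) :=
    fun r => IsFractionRing.lift_algebraMap hinj r
  obtain ⟨G, hG⟩ := exists_ringHom_algebraicClosure
    ((algebraMap (FractionRing S) (FracAlg S)).comp gL)
  refine ⟨G, RingHom.ext fun r => ?_, fun x => ?_⟩
  · exact (hG _).trans (congrArg (algebraMap (FractionRing S) (FracAlg S)) (hgL r))
  · refine congrArg (fun f : AbsoluteValue (FracAlg R) ℝ => f x) (eq_algAbs_of_extends p R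
      ((algAbs p S).comp (RingHom.injective G)) fun y => ?_)
    refine (congrArg (algAbs p S) (hG y)).trans ?_
    rw [RingHom.comp_apply, algAbs_algebraMap]
    obtain ⟨a, b, -, rfl⟩ := IsFractionRing.div_surjective (A := R) y
    rw [map_div₀, hgL, hgL, map_div₀, map_div₀, fieldAbs_map, fieldAbs_map]

end Extension

/-! ### Conjugates of the image of a uniformizer -/

section Degree

variable (p : ℕ) [Fact p.Prime] {R S : Type*}
  [CommRing R] [IsDomain R] [IsDiscreteValuationRing R] [CharZero R]
  [IsAdicComplete (maximalIdeal R) R] [CharP (ResidueField R) p] [PerfectField (ResidueField R)]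
  [CommRing S] [IsDomain S] [IsDiscreteValuationRing S] [CharZero S]
  [IsAdicComplete (maximalIdeal S) S] [CharP (ResidueField S) p] [PerfectField (ResidueField S)]

/-- W(k) is unramified: a nonzero Witt vector is a power of p times a unit. -/
theorem fieldAbs_wittHom {w : WittVector p (ResidueField S)} (hw : w ≠ 0) :
    ∃ n : ℤ, fieldAbs p S (algebraMap S _ (wittHom p S w)) = (p : ℝ) ^ n := by
  obtain ⟨m, b, rfl⟩ := WittVector.exists_eq_pow_p_mul' w hw
  refine ⟨-m, ?_⟩
  rw [map_mul, map_pow, map_natCast, map_mul, map_pow, map_natCast, map_mul, map_pow,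
    fieldAbs_natCast,
    show wittHom p S b = (Units.map (wittHom p S : _ →* S) b : Sˣ) from rfl, fieldAbs_unit,
    mul_one, zpow_neg, zpow_natCast, inv_pow]

theorem fieldAbs_wittField {c : FractionRing S} (hc : c ∈ wittField p S) (hc0 : c ≠ 0) :
    ∃ n : ℤ, fieldAbs p S c = (p : ℝ) ^ n := by
  rw [wittField, Subfield.mem_closure_iff] at hc
  obtain ⟨y, hy, z, hz, rfl⟩ := hc
  rw [← RingHom.coe_range, Subring.closure_eq] at hy hz
  obtain ⟨a, rfl⟩ := hy
  obtain ⟨b, rfl⟩ := hz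
  have ha : a ≠ 0 := by rintro rfl; simp at hc0
  have hb : b ≠ 0 := by rintro rfl; simp at hc0
  obtain ⟨m, hm⟩ := fieldAbs_wittHom p ha
  obtain ⟨n, hn⟩ := fieldAbs_wittHom p hb
  refine ⟨m - n, ?_⟩
  rw [map_div₀, RingHom.comp_apply, RingHom.comp_apply, hm, hn, zpow_sub₀]
  exact_mod_cast (Fact.out : p.Prime).ne_zero

omit [IsAdicComplete (maximalIdeal R) R] [PerfectField (ResidueField R)] in
/-- The image of a uniformizer of `R` has degree at least `ν(p)` over the fraction field of the
Witt vectors. -/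
theorem ramIdx_le_natDegree (g : R →+* S) {π : R} (hπ : Irreducible π)
    {q : Polynomial (wittField p S)} (hq : q ≠ 0)
    (hroot : Polynomial.aeval (algebraMap S (FractionRing S) (g π)) q = 0) :
    ramIdx p R ≤ q.natDegree := by
  by_contra! hlt
  set t := algebraMap S (FractionRing S) (g π)
  have hp1 : (1 : ℝ) < p := by exact_mod_cast (Fact.out : p.Prime).one_lt
  have ht : fieldAbs p S t ^ ramIdx p R = (p : ℝ)⁻¹ := fieldAbs_map_uniformizer_pow p g hπ
  have ht0 : t ≠ 0 := by
    rintro h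
    rw [h, map_zero, zero_pow (ramIdx_pos p R).ne'] at ht
    exact (inv_pos.mpr (zero_lt_one.trans hp1)).ne ht
  let l : ℕ → FractionRing S := fun i => q.coeff i * t ^ i
  -- The exponents are distinct modulo e = `ramIdx p R`, since every i is less than e. Hence the
  -- terms have distinct absolute values, and a largest one cannot cancel.
  have hval : ∀ i ∈ q.support, ∃ n : ℤ,
      fieldAbs p S (l i) ^ ramIdx p R = (p : ℝ) ^ (n * ramIdx p R - i) := by
    intro i hi
    obtain ⟨n, hn⟩ := fieldAbs_wittField p (q.coeff i).2
      (by simpa using Polynomial.mem_support_iff.mp hi)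
    refine ⟨n, ?_⟩
    rw [map_mul, map_pow, mul_pow, hn, ← pow_mul, mul_comm i, pow_mul, ht, inv_pow,
      zpow_sub₀ (zero_lt_one.trans hp1).ne', zpow_mul, zpow_natCast, zpow_natCast, div_eq_mul_inv]
  have hne : ∀ i ∈ q.support, ∀ j ∈ q.support, i ≠ j →
      fieldAbs p S (l i) ≠ fieldAbs p S (l j) := by
    intro i hi j hj hij h
    obtain ⟨m, hm⟩ := hval i hi
    obtain ⟨n, hn⟩ := hval j hj
    rw [h, hn] at hm
    have h1 := zpow_right_injective₀ (zero_lt_one.trans hp1) hp1.ne' hm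
    have hi' := (Polynomial.le_natDegree_of_mem_supp i hi).trans_lt hlt
    have hj' := (Polynomial.le_natDegree_of_mem_supp j hj).trans_lt hlt
    have h2 : (n - m) * (ramIdx p R : ℤ) = j - i := by linarith
    have h3 : n - m = 0 := by
      by_contra h0
      rcases lt_or_gt_of_ne h0 with h4 | h4 <;> nlinarith
    rw [h3] at h2
    exact hij (by omega)
  obtain ⟨k, hk, hmax⟩ := q.support.exists_max_image (fun i => fieldAbs p S (l i))
    (Polynomial.support_nonempty.mpr hq)
  have hsum := (isNonarchimedean_fieldAbs p S).apply_sum_eq_of_lt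
    (fun a => ((fieldAbs p S).map_neg a).symm) hk
    (fun j hj hjk => lt_of_le_of_ne (hmax j hj) (hne j hj k hk hjk))
  rw [Polynomial.aeval_def, Polynomial.eval₂_eq_sum, Polynomial.sum] at hroot
  have h0 : ∑ i ∈ q.support, l i = 0 := hroot
  rw [h0, map_zero] at hsum
  have h1 := (AbsoluteValue.eq_zero (fieldAbs p S)).mp hsum.symm
  rw [mul_eq_zero] at h1
  rcases h1 with h1 | h1
  · exact Polynomial.mem_support_iff.mp hk (by simpa using h1)
  · exact pow_ne_zero k ht0 h1

theorem wittHom_mem_wittField (w : WittVector p (ResidueField S)) :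
    algebraMap S (FractionRing S) (wittHom p S w) ∈ wittField p S :=
  Subfield.subset_closure ⟨w, rfl⟩

theorem isAlgebraic_wittField : Algebra.IsAlgebraic (wittField p S) (FractionRing S) := by
  obtain ⟨π, hπ⟩ := IsDiscreteValuationRing.exists_irreducible S
  have hW : ∀ w, IsIntegral (wittField p S) (algebraMap S (FractionRing S) (wittHom p S w)) :=
    fun w => isIntegral_algebraMap (x := (⟨_, wittHom_mem_wittField p w⟩ : wittField p S))
  have hπi : IsIntegral (wittField p S) (algebraMap S (FractionRing S) π) := by
    obtain ⟨F, hF, -, h0⟩ := exists_monic_eval₂_wittHom_eq_zero p hπ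
    refine ⟨F.map (((algebraMap S (FractionRing S)).comp (wittHom p S)).codRestrict
      (wittField p S) (wittHom_mem_wittField p)), hF.map _, ?_⟩
    rw [Polynomial.eval₂_map]
    have h1 := congrArg (algebraMap S (FractionRing S)) h0
    rw [Polynomial.hom_eval₂, map_zero] at h1
    exact h1
  have hS : ∀ s, IsIntegral (wittField p S) (algebraMap S (FractionRing S) s) := by
    intro s
    obtain ⟨a, rfl⟩ := exists_eq_sum_wittHom p hπ s
    rw [map_sum]
    refine IsIntegral.sum _ fun i _ => ?_
    rw [map_mul, map_pow]
    exact (hW _).mul (hπi.pow _)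
  refine ⟨fun x => ?_⟩
  obtain ⟨a, b, -, rfl⟩ := IsFractionRing.div_surjective (A := S) x
  rw [div_eq_mul_inv]
  exact ((hS a).mul (hS b).inv).isAlgebraic

/-- The conjugates over the fraction field of the Witt vectors of the image of a uniformizer. -/
theorem exists_algHom_apply_eq_iff (g : R →+* S) {π : R} (hπ : Irreducible π)
    {F : Polynomial (WittVector p (ResidueField R))} (hF : F.Monic)
    (hdeg : F.natDegree = ramIdx p R) (h0 : F.eval₂ (wittHom p R) π = 0) (y : FracAlg S) :
    (∃ σ : FractionRing S →ₐ[wittField p S] FracAlg S,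
      σ (algebraMap S (FractionRing S) (g π)) = y) ↔
    F.eval₂ ((toAlg S).comp (g.comp (wittHom p R))) y = 0 := by
  have hmem : ∀ w, ((algebraMap S (FractionRing S)).comp (g.comp (wittHom p R))) w ∈
      wittField p S := by
    intro w
    obtain ⟨z, hz⟩ := map_wittHom p g w
    rw [RingHom.comp_apply, RingHom.comp_apply, hz]
    exact wittHom_mem_wittField p z
  let c : WittVector p (ResidueField R) →+* wittField p S :=
    ((algebraMap S (FractionRing S)).comp (g.comp (wittHom p R))).codRestrict _ hmem
  have hGroot : Polynomial.aeval (algebraMap S (FractionRing S) (g π)) (F.map c) = 0 := by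
    have h1 := congrArg ((algebraMap S (FractionRing S)).comp g) h0
    rw [Polynomial.hom_eval₂, map_zero] at h1
    rw [Polynomial.aeval_def, Polynomial.eval₂_map]
    exact h1
  -- The degree of F attains the lower bound from `ramIdx_le_natDegree`.
  have hmin : F.map c = minpoly (wittField p S) (algebraMap S (FractionRing S) (g π)) := by
    refine minpoly.unique' _ _ (hF.map c) hGroot fun q hq => ?_
    by_contra! h
    have h1 := ramIdx_le_natDegree p g hπ h.1 h.2
    have h2 := Polynomial.natDegree_lt_natDegree h.1 hq
    rw [hF.natDegree_map, hdeg] at h2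
    omega
  have haeval : Polynomial.aeval y (F.map c) =
      F.eval₂ ((toAlg S).comp (g.comp (wittHom p R))) y := by
    rw [Polynomial.aeval_def, Polynomial.eval₂_map]
    rfl
  have := isAlgebraic_wittField p (S := S)
  rw [← haeval, hmin]
  constructor
  · rintro ⟨σ, rfl⟩
    rw [Polynomial.aeval_algHom_apply, minpoly.aeval, map_zero]
  · intro h
    exact IntermediateField.exists_algHom_of_splits_of_aeval
      (fun s => ⟨(Algebra.IsAlgebraic.isAlgebraic s).isIntegral, IsAlgClosed.splits _⟩) h

/-- A root of the image of a monic polynomial is the image of a root. -/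
theorem exists_eval₂_eq_zero_of_map {K L A : Type*} [Field K] [IsAlgClosed K] [Field L] [CommRing A]
    (G : K →+* L) (c : A →+* K) {F : Polynomial A} (hF : F.Monic) {y : L}
    (hy : F.eval₂ (G.comp c) y = 0) : ∃ z, F.eval₂ c z = 0 ∧ G z = y := by
  have h1 : ((F.map c).map G).IsRoot y := by
    rw [Polynomial.IsRoot.def, Polynomial.eval_map, Polynomial.eval₂_map]
    exact hy
  obtain ⟨z, rfl⟩ := (IsAlgClosed.splits (F.map c)).mem_range_of_isRoot (hF.map c).ne_zero h1
  refine ⟨z, G.injective ?_, rfl⟩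
  rw [Polynomial.hom_eval₂, hy, map_zero]

end Degree

/-! ### Ultrametric estimates -/

section Nonarchimedean

variable {K : Type*} [Field K] {v : AbsoluteValue K ℝ} (hv : IsNonarchimedean v)
include hv

theorem abv_sub_le_max (a b : K) : v (a - b) ≤ max (v a) (v b) := by
  rw [sub_eq_add_neg, ← v.map_neg b]
  exact hv a (-b)

/-- Isosceles principle: two unequal sides force the third to equal the larger. With a = g(π) - β
and b = σ(g(π)) - β it eliminates β from the right-hand side. -/
theorem abv_lt_iff_lt_abv_sub (a b : K) : v a < v b ↔ v a < v (a - b) := by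
  have h1 := abv_sub_le_max hv a b
  have h2 := abv_sub_le_max hv a (a - b)
  rw [sub_sub_cancel] at h2
  constructor
  · intro h
    by_contra! h'
    exact absurd (h.trans_le h2) (by rw [max_eq_left h']; exact lt_irrefl _)
  · intro h
    by_contra! h'
    exact absurd (h.trans_le h1) (by rw [max_eq_left h']; exact lt_irrefl _)

/-- If |x| > 1, the leading term strictly dominates all others. -/
theorem abv_le_one_of_monic {A : Type*} [CommRing A] {c : A →+* K} (hc : ∀ a, v (c a) ≤ 1)
    {F : Polynomial A} (hF : F.Monic) {x : K} (h0 : F.eval₂ c x = 0) : v x ≤ 1 := by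
  by_contra! hx
  have h := hv.apply_sum_eq_of_lt (fun a => (v.map_neg a).symm)
    (s := Finset.range (F.natDegree + 1)) (l := fun i => c (F.coeff i) * x ^ i)
    (k := F.natDegree) (by simp) (fun j hj hjk => by
      simp only [hF.coeff_natDegree, map_one, one_mul, map_mul, map_pow]
      have hj' : j < F.natDegree := by
        rw [Finset.mem_range] at hj
        omega
      calc v (c (F.coeff j)) * v x ^ j ≤ 1 * v x ^ j := by gcongr; exact hc _
        _ = v x ^ j := one_mul _
        _ < v x ^ F.natDegree := pow_lt_pow_right₀ hx hj')
  rw [← Polynomial.eval₂_eq_sum_range, h0, hF.coeff_natDegree, map_zero, map_one, one_mul,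
    map_pow] at h
  exact (pow_pos (zero_lt_one.trans hx) _).ne h

/-- Integral polynomials are 1-Lipschitz on the unit ball; this is how control at π spreads to all
of W(k)[π]. -/
theorem abv_eval₂_sub_le {A : Type*} [CommRing A] {c : A →+* K} (hc : ∀ a, v (c a) ≤ 1)
    (F : Polynomial A) {x y : K} (hx : v x ≤ 1) (hy : v y ≤ 1) :
    v (F.eval₂ c x - F.eval₂ c y) ≤ v (x - y) := by
  have hpow : ∀ n, v (x ^ n - y ^ n) ≤ v (x - y) := by
    intro n
    induction n with
    | zero => simp
    | succ n ih =>
      rw [show x ^ (n + 1) - y ^ (n + 1) = x * (x ^ n - y ^ n) + (x - y) * y ^ n by ring]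
      refine (hv _ _).trans (max_le ?_ ?_)
      · rw [map_mul]
        exact (mul_le_of_le_one_left (v.nonneg _) hx).trans ih
      · rw [map_mul, map_pow]
        exact mul_le_of_le_one_right (v.nonneg _) (pow_le_one₀ (v.nonneg _) hy)
  induction F using Polynomial.induction_on' with
  | add f g hf hg =>
    rw [Polynomial.eval₂_add, Polynomial.eval₂_add, add_sub_add_comm]
    exact (hv _ _).trans (max_le hf hg)
  | monomial n a =>
    rw [Polynomial.eval₂_monomial, Polynomial.eval₂_monomial, ← mul_sub, map_mul]
    exact (mul_le_of_le_one_left (v.nonneg _) (hc a)).trans (hpow n)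

end Nonarchimedean

/-! ### Distances between conjugates -/

section Conjugates

variable (p : ℕ) [Fact p.Prime] (R : Type*)
  [CommRing R] [IsDomain R] [IsDiscreteValuationRing R] [CharZero R]
  [IsAdicComplete (maximalIdeal R) R] [CharP (ResidueField R) p] [PerfectField (ResidueField R)]

/-- `r` is smaller than the distance from any uniformizer of `R` to its other conjugates over the
fraction field of the Witt vectors. -/
def LtConjDist (r : ℝ) : Prop :=
  ∀ π : R, Irreducible π → ∀ σ : FractionRing R →ₐ[wittField p R] FracAlg R,
    σ (algebraMap R (FractionRing R) π) ≠ toAlg R π →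
    r < algAbs p R (toAlg R π - σ (algebraMap R (FractionRing R) π))

variable {p R}

theorem LtConjDist.mono {r s : ℝ} (hs : LtConjDist p R s) (hrs : r ≤ s) : LtConjDist p R r :=
  fun π hπ σ hσ => hrs.trans_lt (hs π hπ σ hσ)

theorem LtConjDist.max {r s : ℝ} (hr : LtConjDist p R r) (hs : LtConjDist p R s) :
    LtConjDist p R (max r s) :=
  fun π hπ σ hσ => max_lt (hr π hπ σ hσ) (hs π hπ σ hσ)

variable (p) in
omit [PerfectField (ResidueField R)] in
theorem algAbs_toAlg (x : R) : algAbs p R (toAlg R x) = fieldAbs p R (algebraMap R _ x) :=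
  algAbs_algebraMap p R _

variable (p) in
omit [PerfectField (ResidueField R)] in
theorem algAbs_toAlg_le_one (x : R) : algAbs p R (toAlg R x) ≤ 1 :=
  (algAbs_toAlg p x).trans_le (fieldAbs_le_one p x)

theorem algHom_wittHom (σ : FractionRing R →ₐ[wittField p R] FracAlg R)
    (w : WittVector p (ResidueField R)) :
    σ (algebraMap R (FractionRing R) (wittHom p R w)) = toAlg R (wittHom p R w) :=
  σ.commutes ⟨_, wittHom_mem_wittField p w⟩

theorem algAbs_algHom_le_one {π : R} (hπ : Irreducible π)
    (σ : FractionRing R →ₐ[wittField p R] FracAlg R) :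
    algAbs p R (σ (algebraMap R (FractionRing R) π)) ≤ 1 := by
  obtain ⟨F, hF, hdeg, h0⟩ := exists_monic_eval₂_wittHom_eq_zero p hπ
  exact abv_le_one_of_monic (c := (toAlg R).comp (wittHom p R)) (isNonarchimedean_algAbs p R) (fun _ =>
    algAbs_toAlg_le_one p _) hF
    ((exists_algHom_apply_eq_iff p (RingHom.id R) hπ hF hdeg h0 _).mp ⟨σ, rfl⟩)

/-- Write x = A(π) with A over W(k): σ fixes the coefficients, so the Lipschitz estimate applies. No
element of R is moved further than a uniformizer. -/
theorem algAbs_sub_algHom_le {π : R} (hπ : Irreducible π) (x : R)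
    (σ : FractionRing R →ₐ[wittField p R] FracAlg R) :
    algAbs p R (toAlg R x - σ (algebraMap R (FractionRing R) x)) ≤
      algAbs p R (toAlg R π - σ (algebraMap R (FractionRing R) π)) := by
  obtain ⟨A, rfl⟩ := exists_eval₂_wittHom_eq p hπ x
  have h1 : σ (algebraMap R (FractionRing R) (A.eval₂ (wittHom p R) π)) =
      A.eval₂ ((toAlg R).comp (wittHom p R)) (σ (algebraMap R (FractionRing R) π)) := by
    have h := Polynomial.hom_eval₂ A (wittHom p R)
      ((σ : FractionRing R →+* FracAlg R).comp (algebraMap R (FractionRing R))) π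
    refine h.trans ?_
    congr 1
    exact RingHom.ext fun w => algHom_wittHom σ w
  rw [h1, Polynomial.hom_eval₂]
  exact abv_eval₂_sub_le (c := (toAlg R).comp (wittHom p R)) (isNonarchimedean_algAbs p R)
    (fun _ => algAbs_toAlg_le_one p _) A
    (algAbs_toAlg_le_one p π) (algAbs_algHom_le_one hπ σ)

/-- Any two uniformizers bound each other's displacement, so they are moved by the same σ and
equally far. -/
theorem ltConjDist_of_irreducible {π : R} (hπ : Irreducible π) {r : ℝ}
    (h : ∀ σ : FractionRing R →ₐ[wittField p R] FracAlg R,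
      σ (algebraMap R (FractionRing R) π) ≠ toAlg R π →
      r < algAbs p R (toAlg R π - σ (algebraMap R (FractionRing R) π))) : LtConjDist p R r := by
  intro ϖ hϖ σ hσ
  refine (h σ fun h0 => hσ ?_).trans_le (algAbs_sub_algHom_le hϖ π σ)
  have h1 := algAbs_sub_algHom_le hπ ϖ σ
  rw [h0, sub_self, map_zero] at h1
  exact (sub_eq_zero.mp ((algAbs p R).eq_zero.mp (h1.antisymm ((algAbs p R).nonneg _)))).symm

variable {S : Type*} [CommRing S] [IsDomain S] [IsDiscreteValuationRing S] [CharZero S]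
  [IsAdicComplete (maximalIdeal S) S] [CharP (ResidueField S) p] [PerfectField (ResidueField S)]

/-- Both sets of conjugates are the roots of one monic polynomial over W(k), and all roots of its
image under G come from roots in the source. -/
theorem exists_extension_algAbs_conjugates (g : R →+* S) {π : R} (hπ : Irreducible π) :
    ∃ G : FracAlg R →+* FracAlg S, G.comp (toAlg R) = (toAlg S).comp g ∧
      (∀ x, algAbs p S (G x) = algAbs p R x) ∧
      (∀ σ : FractionRing S →ₐ[wittField p S] FracAlg S,
        ∃ τ : FractionRing R →ₐ[wittField p R] FracAlg R,
        G (τ (algebraMap R _ π)) = σ (algebraMap S _ (g π))) ∧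
      ∀ τ : FractionRing R →ₐ[wittField p R] FracAlg R,
        ∃ σ : FractionRing S →ₐ[wittField p S] FracAlg S,
        σ (algebraMap S _ (g π)) = G (τ (algebraMap R _ π)) := by
  obtain ⟨G, hG, habs⟩ := exists_extension_algAbs p g
  obtain ⟨F, hF, hdeg, h0⟩ := exists_monic_eval₂_wittHom_eq_zero p hπ
  have hR := exists_algHom_apply_eq_iff p (RingHom.id R) hπ hF hdeg h0
  have hS := exists_algHom_apply_eq_iff p g hπ hF hdeg h0
  rw [← RingHom.comp_assoc, ← hG, RingHom.comp_assoc] at hS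
  refine ⟨G, hG, habs, fun σ => ?_, fun τ => ?_⟩
  · obtain ⟨z, hz, hGz⟩ := exists_eval₂_eq_zero_of_map G _ hF ((hS _).mp ⟨σ, rfl⟩)
    obtain ⟨τ, hτ⟩ := (hR z).mpr hz
    exact ⟨τ, by rw [← hGz, ← hτ]; rfl⟩
  · refine (hS _).mpr ?_
    rw [← Polynomial.hom_eval₂]
    exact (congrArg G ((hR _).mp ⟨τ, rfl⟩)).trans (map_zero G)

theorem ltConjDist_iff_map (g : R →+* S) {π : R} (hπ : Irreducible π) {r : ℝ} :
    LtConjDist p R r ↔ ∀ σ : FractionRing S →ₐ[wittField p S] FracAlg S,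
      σ (algebraMap S (FractionRing S) (g π)) ≠ toAlg S (g π) →
      r < algAbs p S (toAlg S (g π) - σ (algebraMap S (FractionRing S) (g π))) := by
  obtain ⟨G, hG, habs, h1, h2⟩ := exists_extension_algAbs_conjugates (p := p) g hπ
  have hGπ : toAlg S (g π) = G (toAlg R π) := (RingHom.congr_fun hG π).symm
  constructor
  · intro h σ hσ
    obtain ⟨τ, hτ⟩ := h1 σ
    rw [← hτ, hGπ, ← map_sub, habs]
    refine h π hπ τ fun h0 => hσ ?_
    rw [← hτ, hGπ, h0]
  · intro h
    refine ltConjDist_of_irreducible hπ fun τ hτ => ?_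
    obtain ⟨σ, hσ⟩ := h2 τ
    have h3 := h σ (by rw [hσ, hGπ]; exact fun h0 => hτ (G.injective h0))
    rwa [hσ, hGπ, ← map_sub, habs] at h3

-- Applying g to p = uπ^e and comparing valuations gives e = e · ν(g(π)).
omit [IsAdicComplete (maximalIdeal R) R] [PerfectField (ResidueField R)]
  [IsAdicComplete (maximalIdeal S) S] [CharP (ResidueField S) p]
  [PerfectField (ResidueField S)] in
theorem irreducible_map_of_ramIdx_eq (he : ramIdx p R = ramIdx p S) (g : R →+* S) {π : R}
    (hπ : Irreducible π) : Irreducible (g π) := by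
  obtain ⟨ϖ, hϖ⟩ := IsDiscreteValuationRing.exists_irreducible S
  obtain ⟨u, hu⟩ := exists_natCast_eq_unit_mul_pow p hπ
  have h := congrArg (fun x => IsDiscreteValuationRing.addVal S (g x)) hu
  simp only [map_natCast, map_mul, map_pow, IsDiscreteValuationRing.addVal_mul,
    IsDiscreteValuationRing.addVal_pow, addVal_natCast_prime] at h
  rw [show g u = (Units.map (g : R →* S) u : Sˣ) from rfl,
    IsDiscreteValuationRing.addVal_eq_zero_of_unit, zero_add, ← he] at h
  have h0 : g π ≠ 0 := (map_ne_zero_iff g (injective_of_mixedChar p g)).mpr hπ.ne_zero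
  obtain ⟨n, v, hv⟩ := IsDiscreteValuationRing.eq_unit_mul_pow_irreducible h0 hϖ
  rw [hv, IsDiscreteValuationRing.addVal_def' v hϖ, nsmul_eq_mul] at h
  have h1 : ramIdx p R = ramIdx p R * n := by exact_mod_cast h
  have h2 : n = 1 := (mul_right_eq_self₀.mp h1.symm).resolve_right (ramIdx_pos p R).ne'
  rw [hv, h2, pow_one, irreducible_units_mul]
  exact hϖ

/-- The conjugate distances of R can be measured at g(π), which is a uniformizer of S. -/
theorem ltConjDist_iff_of_ramIdx_eq (he : ramIdx p R = ramIdx p S) (g : R →+* S) {r : ℝ} :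
    LtConjDist p R r ↔ LtConjDist p S r := by
  obtain ⟨π, hπ⟩ := IsDiscreteValuationRing.exists_irreducible R
  rw [ltConjDist_iff_map g hπ,
    ltConjDist_iff_map (RingHom.id S) (irreducible_map_of_ramIdx_eq he g hπ)]
  rfl

/-- Finiteness allows the strict inequality for the supremum to be checked term by term. -/
theorem finite_conjugates (g : R →+* S) {π : R} (hπ : Irreducible π) :
    {y | ∃ σ : FractionRing S →ₐ[wittField p S] FracAlg S,
      σ (algebraMap S (FractionRing S) (g π)) = y}.Finite := by
  obtain ⟨F, hF, hdeg, h0⟩ := exists_monic_eval₂_wittHom_eq_zero p hπ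
  refine (Polynomial.finite_setOfPred_isRoot
    (hF.map ((toAlg S).comp (g.comp (wittHom p R)))).ne_zero).subset fun y hy => ?_
  change Polynomial.eval y _ = 0
  rw [Polynomial.eval_map]
  exact (exists_algHom_apply_eq_iff p g hπ hF hdeg h0 y).mp hy

/-- The Krasner type condition in the definition of a lifting, in terms of absolute values. -/
theorem sSup_algVal_lt_iff (g : R →+* S) {π : R} (hπ : Irreducible π) (β : S) :
    sSup {t : EReal | ∃ σ : FractionRing S →ₐ[wittField p S] FracAlg S,
      σ (algebraMap S (FractionRing S) (g π)) ≠ toAlg S (g π) ∧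
      t = algVal p S (σ (algebraMap S (FractionRing S) (g π)) - toAlg S β)} <
    algVal p S (toAlg S (g π) - toAlg S β) ↔
    LtConjDist p R (algAbs p S (toAlg S (g π) - toAlg S β)) := by
  set T := {t : EReal | ∃ σ : FractionRing S →ₐ[wittField p S] FracAlg S,
      σ (algebraMap S (FractionRing S) (g π)) ≠ toAlg S (g π) ∧
      t = algVal p S (σ (algebraMap S (FractionRing S) (g π)) - toAlg S β)} with hT
  have hfin : T.Finite := by
    refine ((finite_conjugates (p := p) g hπ).image (fun y => algVal p S (y - toAlg S β))).subset ?_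
    rintro t ⟨σ, -, rfl⟩
    exact ⟨_, ⟨σ, rfl⟩, rfl⟩
  -- Covers the case without other conjugates, where the supremum is ⊥.
  have hbot : ⊥ < algVal p S (toAlg S (g π) - toAlg S β) := by
    unfold algVal
    split_ifs
    · exact bot_lt_top
    · exact EReal.bot_lt_coe _
  have hsup : sSup T < algVal p S (toAlg S (g π) - toAlg S β) ↔
      ∀ t ∈ T, t < algVal p S (toAlg S (g π) - toAlg S β) := by
    rcases T.eq_empty_or_nonempty with h | h
    · simp [h, hbot]
    · exact hfin.csSup_lt_iff h
  rw [hsup, ltConjDist_iff_map g hπ]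
  have hkey : ∀ y : FracAlg S, algVal p S (y - toAlg S β) <
      algVal p S (toAlg S (g π) - toAlg S β) ↔
      algAbs p S (toAlg S (g π) - toAlg S β) < algAbs p S (toAlg S (g π) - y) := by
    intro y
    rw [algVal_lt_algVal_iff, abv_lt_iff_lt_abv_sub (isNonarchimedean_algAbs p S),
      sub_sub_sub_cancel_right]
  constructor
  · intro h σ hσ
    exact (hkey _).mp (h _ ⟨σ, hσ, rfl⟩)
  · rintro h _ ⟨σ, hσ, rfl⟩
    exact (hkey _).mpr (h σ hσ)

/-! ### Liftings: approximation at all elements and uniqueness -/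

variable {n₁ n₂ : ℕ} [NeZero n₂] {φ : ResRing R n₁ →+* ResRing S n₂} {g : R →+* S}

theorem isLiftingAt_iff {π : R} (hπ : Irreducible π) :
    IsLiftingAt p φ π g ↔
      (∃ β : S, Ideal.Quotient.mk (maximalIdeal S ^ n₂) β =
          φ (Ideal.Quotient.mk (maximalIdeal R ^ n₁) π) ∧
        LtConjDist p R (algAbs p S (toAlg S (g π) - toAlg S β))) ∧
      (redHom φ).comp (residue R) = (residue S).comp g := by
  constructor
  · rintro ⟨⟨β, h1, h2⟩, h3⟩
    exact ⟨⟨β, h1, (sSup_algVal_lt_iff g hπ β).mp h2⟩, h3⟩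
  · rintro ⟨⟨β, h1, h2⟩, h3⟩
    exact ⟨⟨β, h1, (sSup_algVal_lt_iff g hπ β).mpr h2⟩, h3⟩

/-- If `g` is a lifting of `φ` at some uniformizer then it is close to `φ` at every element. -/
theorem IsLiftingAt.exists_representative_of_irreducible {π : R} (hπ : Irreducible π)
    (h : IsLiftingAt p φ π g) (x : R) :
    ∃ β : S, Ideal.Quotient.mk (maximalIdeal S ^ n₂) β =
        φ (Ideal.Quotient.mk (maximalIdeal R ^ n₁) x) ∧
      LtConjDist p R (algAbs p S (toAlg S (g x) - toAlg S β)) := by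
  obtain ⟨⟨β, h1, h2⟩, h3⟩ := (isLiftingAt_iff hπ).mp h
  obtain ⟨A, rfl⟩ := exists_eval₂_wittHom_eq p hπ x
  -- With x = A(π), the representative is A with coefficients moved by g, evaluated at β instead of
  -- g(π).
  refine ⟨A.eval₂ (g.comp (wittHom p R)) β, ?_, h2.mono ?_⟩
  · rw [Polynomial.hom_eval₂, h1]
    have h4 := Polynomial.hom_eval₂ A (wittHom p R)
      (φ.comp (Ideal.Quotient.mk (maximalIdeal R ^ n₁))) π
    refine Eq.trans ?_ h4.symm
    congr 1
    exact RingHom.ext fun w => (residueRing_map_wittHom p φ h3 w).symm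
  · rw [Polynomial.hom_eval₂, Polynomial.hom_eval₂, Polynomial.hom_eval₂]
    exact abv_eval₂_sub_le (c := (toAlg S).comp (g.comp (wittHom p R)))
      (isNonarchimedean_algAbs p S) (fun _ => algAbs_toAlg_le_one p _) A
      (algAbs_toAlg_le_one p _) (algAbs_toAlg_le_one p _)

/-- Two homomorphisms with the same residue map that are close at a uniformizer are equal. -/
theorem eq_of_ltConjDist {h : R →+* S} (hres : (residue S).comp h = (residue S).comp g)
    {π : R} (hπ : Irreducible π)
    (hlt : LtConjDist p R (algAbs p S (toAlg S (g π) - toAlg S (h π)))) : h = g := by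
  have hW : h.comp (wittHom p R) = g.comp (wittHom p R) := comp_wittHom_eq hres
  have hroot : ∀ F : Polynomial (WittVector p (ResidueField R)),
      h (F.eval₂ (wittHom p R) π) = F.eval₂ (g.comp (wittHom p R)) (h π) := by
    intro F
    rw [Polynomial.hom_eval₂, hW]
  have heq : h π = g π := by
    obtain ⟨F, hF, hdeg, h0⟩ := exists_monic_eval₂_wittHom_eq_zero p hπ
    -- Since h and g agree on W(k), h(π) is a root of the polynomial of g(π), hence a conjugate; if
    -- different from g(π), it would be closer to g(π) than itself.
    obtain ⟨σ, hσ⟩ := (exists_algHom_apply_eq_iff p g hπ hF hdeg h0 (toAlg S (h π))).mpr (by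
      rw [← Polynomial.hom_eval₂, ← hroot, h0, map_zero, map_zero])
    by_contra hne
    have h1 := (ltConjDist_iff_map g hπ).mp hlt σ (by
      rw [hσ]
      exact fun h2 => hne (IsFractionRing.injective S (FractionRing S)
        ((algebraMap (FractionRing S) (FracAlg S)).injective h2)))
    rw [hσ] at h1
    exact lt_irrefl _ h1
  ext x
  obtain ⟨A, rfl⟩ := exists_eval₂_wittHom_eq p hπ x
  rw [hroot, heq, Polynomial.hom_eval₂]

-- In logarithms, |x| is at most p^(-n/e_S), while every nonzero displacement of π is p^(-τ) with τ
-- at most the Krasner bound; so τ e_S < n is what is needed.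
omit [PerfectField (ResidueField S)] in
theorem ltConjDist_of_krasnerBound_lt {π : R} (hπ : Irreducible π) {n : ℕ}
    (hn : krasnerBound p π * ramIdx p R * ramIdx p S < (n : EReal)) {x : S}
    (hx : x ∈ maximalIdeal S ^ n) : LtConjDist p R (algAbs p S (toAlg S x)) := by
  refine ltConjDist_of_irreducible hπ fun σ hσ => ?_
  set d := toAlg R π - σ (algebraMap R (FractionRing R) π) with hd
  have hd0 : d ≠ 0 := fun h => hσ (sub_eq_zero.mp h).symm
  have hpos := (algAbs p R).pos hd0
  have hp : 0 < Real.log p := Real.log_pos (by exact_mod_cast (Fact.out : p.Prime).one_lt)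
  have hd1 : algAbs p R d ≤ 1 := (abv_sub_le_max (isNonarchimedean_algAbs p R) _ _).trans
    (max_le (algAbs_toAlg_le_one p π) (algAbs_algHom_le_one hπ σ))
  set τ := -Real.log (algAbs p R d) / Real.log p with hτ
  have hτ0 : 0 ≤ τ := div_nonneg (neg_nonneg.mpr (Real.log_nonpos hpos.le hd1)) hp.le
  have hle : ((τ : ℝ) : EReal) ≤ krasnerBound p π := by
    rw [hτ, ← algVal_eq_neg_log p hd0]
    exact le_sSup ⟨σ, hσ, rfl⟩
  have h1 : ((τ * ramIdx p R * ramIdx p S : ℝ) : EReal) < ((n : ℝ) : EReal) := by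
    refine lt_of_le_of_lt ?_ hn
    push_cast
    gcongr
  rw [EReal.coe_lt_coe_iff] at h1
  have heR : (1 : ℝ) ≤ ramIdx p R := by exact_mod_cast ramIdx_pos p R
  have heS : (0 : ℝ) < ramIdx p S := by exact_mod_cast ramIdx_pos p S
  -- The factor `ramIdx p R` can be dropped: it is at least 1, and τ ≥ 0 because conjugates of π are
  -- integral.
  have h2 : τ * ramIdx p S < n := by
    refine lt_of_le_of_lt ?_ h1
    gcongr
    exact le_mul_of_one_le_right hτ0 heR
  have hb : 0 < (absBase p S : ℝ) := zero_lt_one.trans (by exact_mod_cast one_lt_absBase p S)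
  rw [algAbs_toAlg]
  refine ((fieldAbs_le_iff_mem p x n).mpr hx).trans_lt ?_
  rw [← Real.log_lt_log_iff (pow_pos (inv_pos.mpr hb) n) hpos, Real.log_pow, Real.log_inv,
    log_absBase]
  have h3 : Real.log (algAbs p R d) = -(τ * Real.log p) := by
    rw [hτ]
    field_simp
  rw [h3, mul_neg, neg_lt_neg_iff, ← mul_div_assoc, lt_div_iff₀ heS]
  nlinarith

end Conjugates

theorem redHom_comp_residue {R S : Type*} [CommRing R] [IsLocalRing R] [CommRing S] [IsLocalRing S]
    {m n : ℕ} [NeZero m] [NeZero n] (φ : ResRing R m →+* ResRing S n) :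
    (redHom φ).comp (resProj R m) = (resProj S n).comp φ := by
  refine Ideal.Quotient.ringHom_ext (RingHom.ext fun x => ?_)
  rfl

end ResidueLifting

end


theorem proposition3p3 (p : ℕ) [Fact p.Prime] {R₁ R₂ R₃ : Type*}
    [CommRing R₁] [IsDomain R₁] [IsDiscreteValuationRing R₁] [CharZero R₁]
    [IsAdicComplete (maximalIdeal R₁) R₁] [CharP (ResidueField R₁) p]
    [PerfectField (ResidueField R₁)]
    [CommRing R₂] [IsDomain R₂] [IsDiscreteValuationRing R₂] [CharZero R₂]
    [IsAdicComplete (maximalIdeal R₂) R₂] [CharP (ResidueField R₂) p]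
    [PerfectField (ResidueField R₂)]
    [CommRing R₃] [IsDomain R₃] [IsDiscreteValuationRing R₃] [CharZero R₃]
    [IsAdicComplete (maximalIdeal R₃) R₃] [CharP (ResidueField R₃) p]
    [PerfectField (ResidueField R₃)]
    {π₁ : R₁} {π₂ : R₂} (hπ₁ : Irreducible π₁) (hπ₂ : Irreducible π₂)
    {n₁ n₂ n₃ : ℕ} [NeZero n₁] [NeZero n₂] [NeZero n₃]
    (φ₁₂ : ResidueLifting.ResRing R₁ n₁ →+* ResidueLifting.ResRing R₂ n₂)
    (φ₂₃ : ResidueLifting.ResRing R₂ n₂ →+* ResidueLifting.ResRing R₃ n₃)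
    (g₁₂ : R₁ →+* R₂) (g₂₃ : R₂ →+* R₃)
    (h₁₂ : ResidueLifting.IsLiftingAt p φ₁₂ π₁ g₁₂)
    (h₂₃ : ResidueLifting.IsLiftingAt p φ₂₃ π₂ g₂₃)
    (he : ResidueLifting.ramIdx p R₁ = ResidueLifting.ramIdx p R₂) :
    (∀ ϖ : R₁, Irreducible ϖ →
      ResidueLifting.IsLiftingAt p (φ₂₃.comp φ₁₂) ϖ (g₂₃.comp g₁₂)) ∧
    (ResidueLifting.krasnerBound p π₂ * ResidueLifting.ramIdx p R₂ * ResidueLifting.ramIdx p R₃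
        < (n₃ : EReal) →
      ResidueLifting.krasnerBound p π₁ * ResidueLifting.ramIdx p R₁ * ResidueLifting.ramIdx p R₂
        < (n₂ : EReal) →
      ∀ ϖ : R₁, Irreducible ϖ → ∀ h : R₁ →+* R₃,
        ResidueLifting.IsLiftingAt p (φ₂₃.comp φ₁₂) ϖ h → h = g₂₃.comp g₁₂) := by

  have key : ∀ ϖ : R₁, ∃ γ : R₃, Ideal.Quotient.mk (maximalIdeal R₃ ^ n₃) γ =
        (φ₂₃.comp φ₁₂) (Ideal.Quotient.mk (maximalIdeal R₁ ^ n₁) ϖ) ∧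
      ResidueLifting.LtConjDist p R₁ (ResidueLifting.algAbs p R₃
        (ResidueLifting.toAlg R₃ (g₂₃.comp g₁₂ ϖ) - ResidueLifting.toAlg R₃ γ)) := by
    intro ϖ
    obtain ⟨β, hβ, hβ'⟩ := h₁₂.exists_representative_of_irreducible hπ₁ ϖ
    -- β need not be a uniformizer, which is why closeness at every element is required.
    obtain ⟨γ, hγ, hγ'⟩ := h₂₃.exists_representative_of_irreducible hπ₂ β
    refine ⟨γ, by rw [hγ, hβ, RingHom.comp_apply],
      (hβ'.max ((ResidueLifting.ltConjDist_iff_of_ramIdx_eq he g₁₂).mpr hγ')).mono ?_⟩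
    have h1 : ResidueLifting.algAbs p R₂
        (ResidueLifting.toAlg R₂ (g₁₂ ϖ) - ResidueLifting.toAlg R₂ β) =
        ResidueLifting.algAbs p R₃
          (ResidueLifting.toAlg R₃ (g₂₃ (g₁₂ ϖ)) - ResidueLifting.toAlg R₃ (g₂₃ β)) := by
      rw [← map_sub, ← map_sub, ← map_sub, ResidueLifting.algAbs_toAlg,
        ResidueLifting.algAbs_toAlg, ResidueLifting.fieldAbs_map]
    rw [h1, RingHom.comp_apply,
      ← sub_add_sub_cancel _ (ResidueLifting.toAlg R₃ (g₂₃ β)) (ResidueLifting.toAlg R₃ γ)]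
    exact ResidueLifting.isNonarchimedean_algAbs p R₃ _ _
  have hred : (ResidueLifting.redHom (φ₂₃.comp φ₁₂)).comp (residue R₁) =
      (residue R₃).comp (g₂₃.comp g₁₂) := by
    rw [← RingHom.comp_assoc, ← h₂₃.red_comp_residue, RingHom.comp_assoc, ← h₁₂.red_comp_residue]
    ext x
    exact (RingHom.congr_fun (ResidueLifting.redHom_comp_residue φ₂₃)
      (φ₁₂ (Ideal.Quotient.mk _ x))).symm
  refine ⟨fun ϖ hϖ => (ResidueLifting.isLiftingAt_iff hϖ).mpr ⟨key ϖ, hred⟩, ?_⟩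
  intro hn₃ _ ϖ hϖ h hh
  obtain ⟨γ, hγ, hγ'⟩ := key ϖ
  obtain ⟨⟨δ, hδ, hδ'⟩, hred'⟩ := (ResidueLifting.isLiftingAt_iff hϖ).mp hh
  -- γ approximates the composite and δ approximates h, and both represent the same class; so g(ϖ) -
  -- h(ϖ) splits into three small differences.
  have hmem : γ - δ ∈ maximalIdeal R₃ ^ n₃ := Ideal.Quotient.eq.mp (hγ.trans hδ.symm)
  have hγδ := (ResidueLifting.ltConjDist_iff_of_ramIdx_eq he g₁₂).mpr
    (ResidueLifting.ltConjDist_of_krasnerBound_lt hπ₂ hn₃ hmem)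
  refine ResidueLifting.eq_of_ltConjDist (hred'.symm.trans hred) hϖ
    ((hγ'.max (hγδ.max hδ')).mono ?_)
  have hna := ResidueLifting.isNonarchimedean_algAbs p R₃
  rw [← sub_add_sub_cancel _ (ResidueLifting.toAlg R₃ γ), ← sub_add_sub_cancel
    (ResidueLifting.toAlg R₃ γ) (ResidueLifting.toAlg R₃ δ), ← map_sub _ γ δ]
  refine (hna _ _).trans (max_le_max le_rfl ((hna _ _).trans (max_le_max le_rfl ?_)))
  rw [(ResidueLifting.algAbs p R₃).map_sub]
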